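/- **Proposition 3.4 (Ricci equation for a given immersion).** Let $\varepsilon\in\{-1,1\}$, $c\in\{-1,1\}$, $N\ge 2$ and $0\le\lambda\le N$. Let $\mathbb{R}^{N+1}_\nu$ denote $\mathbb{R}^{N+1}$ with the metric $g_0=\sum_{i=0}^{N-\nu}dx_i^2-\sum_{i=N-\nu+1}^{N}dx_i^2$, and let $\mathbb{M}^N_\lambda(c)$ be a connected component of the hyperquadric $\{p : g_0(p,p)=c\}$ in $\mathbb{R}^{N+1}_{\lambda}$ if $c=1$, and in $\mathbb{R}^{N+1}_{\lambda+1}$ if $c=-1$, with the induced metric $g$. Let $I\subset\mathbb{R}$ be an open interval, let $a:I\to(0,\infty)$ be smooth, and let $\bar P=\varepsilon I\times_a\mathbb{M}^N_\lambda(c)$ be the product $I\times\mathbb{M}^N_\lambda(c)$ with the warped metric $\langle\ ,\ \rangle=\varepsilon\,dt^2+a(t)^2 g$, Levi-Civita connection $\bar\nabla$ and curvature tensor $\bar R$. Curvature operators $\mathcal{R}$ of connections $\mathcal{D}$ follow the convention $\mathcal{R}(X,Y)Z=\mathcal{D}_X\mathcal{D}_YZ-\mathcal{D}_Y\mathcal{D}_XZ-\mathcal{D}_{[X,Y]}Z$.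 Let $M^n$ be a semi-Riemannian manifold isometrically immersed in $\bar P$, with normal bundle $TM^\perp$. Write $(\cdot)^\perp$ for the component normal to $M$, let $\alpha(X,Y)=(\bar\nabla_XY)^\perp$ be the second fundamental form, let $A_\eta$ be the shape operator, given by $\langle A_\eta X,Y\rangle=\langle\alpha(X,Y),\eta\rangle$, and let $R^\perp$ be the curvature of the normal connection $\nabla^\perp_X\eta=(\bar\nabla_X\eta)^\perp$. Then, for all $X,Y\in TM$ and $\eta\in TM^\perp$, $$R^\perp(X,Y)\eta=\alpha(A_\eta Y,X)-\alpha(A_\eta X,Y),$$ and the ambient curvature term of the Ricci equation vanishes: $\big(\bar R(X,Y)\eta\big)^\perp=0$. -/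

import Mathlib

open scoped Manifold ContDiff
open Bundle

noncomputable section

/-! ### Semi-Riemannian metrics and the Levi-Civita connection along a map -/

section SemiRiemannian

variable {E : Type*} [NormedAddCommGroup E] [NormedSpace ℝ E]
  {H : Type*} [TopologicalSpace H] (I : ModelWithCorners ℝ E H)
  {M : Type*} [TopologicalSpace M] [ChartedSpace H M] [IsManifold I ∞ M]
  {F : Type*} [NormedAddCommGroup F] [NormedSpace ℝ F]
  {K : Type*} [TopologicalSpace K] (J : ModelWithCorners ℝ F K)
  {P : Type*} [TopologicalSpace P] [ChartedSpace K P] [IsManifold J ∞ P]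

/-- A smooth semi-Riemannian metric `g` on `M`: a symmetric, nondegenerate bilinear form on every
tangent space, depending smoothly on the point. (On a connected manifold the index is then
constant.) -/
structure IsSemiRiemannianMetric
    (g : Π x : M, TangentSpace I x →L[ℝ] TangentSpace I x →L[ℝ] ℝ) : Prop where
  symm : ∀ (x : M) (u v : TangentSpace I x), g x u v = g x v u
  nondegenerate : ∀ (x : M) (u : TangentSpace I x), (∀ v, g x u v = 0) → u = 0
  contMDiff : ContMDiff I (I.prod 𝓘(ℝ, E →L[ℝ] E →L[ℝ] ℝ)) ∞
    (fun x ↦ TotalSpace.mk' (E →L[ℝ] E →L[ℝ] ℝ)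
      (E := fun x : M ↦ TangentSpace I x →L[ℝ] TangentSpace I x →L[ℝ] ℝ) x (g x))

/-- The map `f` is an isometric immersion of `(M, gM)` into `(P, g)`: it is smooth and pulls `g`
back to `gM`. (Its differentials are injective as soon as `gM` is nondegenerate.) -/
structure IsIsometricImmersion
    (gM : Π x : M, TangentSpace I x →L[ℝ] TangentSpace I x →L[ℝ] ℝ)
    (g : Π p : P, TangentSpace J p →L[ℝ] TangentSpace J p →L[ℝ] ℝ) (f : M → P) : Prop where
  contMDiff : ContMDiff I J ∞ f
  isometric : ∀ (x : M) (u v : TangentSpace I x),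
    gM x u v = g (f x) (mfderiv I J f x u) (mfderiv I J f x v)

/-- The matrix `(g_ij)` of the metric `g` in the preferred chart around `p₀`, as a function of the
coordinates `y`, with values in the bilinear forms on the model space. -/
def metricInChart (g : Π p : P, TangentSpace J p →L[ℝ] TangentSpace J p →L[ℝ] ℝ) (p₀ : P) (y : F) :
    F →L[ℝ] F →L[ℝ] ℝ :=
  let S := (trivializationAt F (TangentSpace J : P → Type _) p₀).symmL ℝ ((extChartAt J p₀).symm y)
  (S.precomp ℝ).comp ((g ((extChartAt J p₀).symm y)).comp S)

/-- The Christoffel symbols `Γ(u, v) = Γ^k_ij u^i v^j` of `g` in the preferred chart around `p₀`,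
at the point with coordinates `y`: the vector with
`2 g(Γ(u, v), w) = ∂_u g(v, w) + ∂_v g(u, w) - ∂_w g(u, v)` for all `w`. -/
def christoffel (g : Π p : P, TangentSpace J p →L[ℝ] TangentSpace J p →L[ℝ] ℝ) (p₀ : P)
    (y u v : F) : F :=
  (metricInChart J g p₀ y).inverse
    ((1 / 2 : ℝ) • (fderiv ℝ (metricInChart J g p₀) y u v + fderiv ℝ (metricInChart J g p₀) y v u
      - ((fderiv ℝ (metricInChart J g p₀) y).flip u).flip v))

/-- The Levi-Civita connection of `(P, g)` along a map `f : M → P` (that is, the pullback to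
`f^* TP` of the Levi-Civita connection of `g`): the covariant derivative at `x`, in the direction
`u`, of the vector field `V` along `f`. In the preferred chart around `f x` it is
`(∇_u V)^k = u(V^k) + Γ^k_ij df(u)^i V^j`.
For `f = id` it is the Levi-Civita connection of `g` on `P`. -/
def covDerivAlong (g : Π p : P, TangentSpace J p →L[ℝ] TangentSpace J p →L[ℝ] ℝ) (f : M → P)
    (V : Π x : M, TangentSpace J (f x)) (x : M) (u : TangentSpace I x) : TangentSpace J (f x) :=
  (mvfderiv I (fun x' ↦ (trivializationAt F (TangentSpace J) (f x)
      (⟨f x', V x'⟩ : TangentBundle J P)).2) x u : F)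
    + christoffel J g (f x) (extChartAt J (f x) (f x)) (mfderiv I J f x u) (V x)

/-- The Riemann curvature tensor `R(u, v)w = ∇_X ∇_Y Z - ∇_Y ∇_X Z - ∇_[X,Y] Z` of `(P, g)` at `p`,
where `X`, `Y`, `Z` are the extensions of `u`, `v`, `w` with constant components in the preferred
chart around `p`. -/
def curvatureTensor (g : Π p : P, TangentSpace J p →L[ℝ] TangentSpace J p →L[ℝ] ℝ) (p : P)
    (u v w : TangentSpace J p) : TangentSpace J p :=
  let X : Π q : P, TangentSpace J q := FiberBundle.extend F u
  let Y : Π q : P, TangentSpace J q := FiberBundle.extend F v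
  let Z : Π q : P, TangentSpace J q := FiberBundle.extend F w
  covDerivAlong J J g id (fun q ↦ covDerivAlong J J g id Z q (Y q)) p u
    - covDerivAlong J J g id (fun q ↦ covDerivAlong J J g id Z q (X q)) p v
    - covDerivAlong J J g id Z p (VectorField.mlieBracket J X Y p)

/-! ### Normal bundle, second fundamental form, shape operator, normal curvature -/

/-- The vector `w ∈ T_{f x} P` is normal to `f` at `x`. -/
def IsNormalTo (g : Π p : P, TangentSpace J p →L[ℝ] TangentSpace J p →L[ℝ] ℝ) (f : M → P) (x : M)
    (w : TangentSpace J (f x)) : Prop :=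
  ∀ u : TangentSpace I x, g (f x) w (mfderiv I J f x u) = 0

/-- The tangential component of `w ∈ T_{f x} P`, as the vector `u ∈ T_x M` with
`gM(u, z) = g(w, df z)` for all `z ∈ T_x M`. -/
def tangentPart (gM : Π x : M, TangentSpace I x →L[ℝ] TangentSpace I x →L[ℝ] ℝ)
    (g : Π p : P, TangentSpace J p →L[ℝ] TangentSpace J p →L[ℝ] ℝ) (f : M → P) (x : M)
    (w : TangentSpace J (f x)) : TangentSpace I x :=
  (gM x).inverse ((g (f x) w).comp (mfderiv I J f x))

/-- The normal component `w^⊥` of `w ∈ T_{f x} P`. -/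
def normalPart (gM : Π x : M, TangentSpace I x →L[ℝ] TangentSpace I x →L[ℝ] ℝ)
    (g : Π p : P, TangentSpace J p →L[ℝ] TangentSpace J p →L[ℝ] ℝ) (f : M → P) (x : M)
    (w : TangentSpace J (f x)) : TangentSpace J (f x) :=
  w - mfderiv I J f x (tangentPart I J gM g f x w)

/-- The second fundamental form `α(u, v) = (∇_u df(V))^⊥` at `x`, where `V` is the extension of `v`
to a vector field on `M` with constant components in the preferred chart around `x`. -/
def secondFundamentalForm (gM : Π x : M, TangentSpace I x →L[ℝ] TangentSpace I x →L[ℝ] ℝ)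
    (g : Π p : P, TangentSpace J p →L[ℝ] TangentSpace J p →L[ℝ] ℝ) (f : M → P) (x : M)
    (u v : TangentSpace I x) : TangentSpace J (f x) :=
  let V : Π x' : M, TangentSpace I x' := FiberBundle.extend E v
  normalPart I J gM g f x (covDerivAlong I J g f (fun x' ↦ mfderiv I J f x' (V x')) x u)

open Classical in
/-- The shape operator: `A_η u` is the vector with `⟨A_η u, v⟩ = ⟨α(u, v), η⟩` for all `v`. -/
def shapeOperator (gM : Π x : M, TangentSpace I x →L[ℝ] TangentSpace I x →L[ℝ] ℝ)
    (g : Π p : P, TangentSpace J p →L[ℝ] TangentSpace J p →L[ℝ] ℝ) (f : M → P) (x : M)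
    (η : TangentSpace J (f x)) (u : TangentSpace I x) : TangentSpace I x :=
  if h : ∃ a : TangentSpace I x, ∀ v : TangentSpace I x,
      gM x a v = g (f x) (secondFundamentalForm I J gM g f x u v) η
  then h.choose else 0

/-- The normal connection `∇^⊥_u η = (∇_u η)^⊥`. -/
def normalConnection (gM : Π x : M, TangentSpace I x →L[ℝ] TangentSpace I x →L[ℝ] ℝ)
    (g : Π p : P, TangentSpace J p →L[ℝ] TangentSpace J p →L[ℝ] ℝ) (f : M → P)
    (η : Π x : M, TangentSpace J (f x)) (x : M) (u : TangentSpace I x) : TangentSpace J (f x) :=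
  normalPart I J gM g f x (covDerivAlong I J g f η x u)

/-- The normal curvature `R^⊥(X, Y)η = ∇^⊥_X ∇^⊥_Y η - ∇^⊥_Y ∇^⊥_X η - ∇^⊥_[X,Y] η`. -/
def normalCurvature (gM : Π x : M, TangentSpace I x →L[ℝ] TangentSpace I x →L[ℝ] ℝ)
    (g : Π p : P, TangentSpace J p →L[ℝ] TangentSpace J p →L[ℝ] ℝ) (f : M → P)
    (X Y : Π x : M, TangentSpace I x) (η : Π x : M, TangentSpace J (f x)) (x : M) :
    TangentSpace J (f x) :=
  normalConnection I J gM g f (fun x' ↦ normalConnection I J gM g f η x' (Y x')) x (X x)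
    - normalConnection I J gM g f (fun x' ↦ normalConnection I J gM g f η x' (X x')) x (Y x)
    - normalConnection I J gM g f η x (VectorField.mlieBracket I X Y x)

end SemiRiemannian

/-! ### The space forms `𝕄^N_λ(c)` -/

section SpaceForm

/-- The signs of the pseudo-Euclidean space `ℝ^{N+1}_ν`: `+1` for the coordinates
`0, …, N - ν`, and `-1` for the last `ν` ones. -/
def pseudoSign (N ν : ℕ) (i : Fin (N + 1)) : ℝ := if (i : ℕ) + ν ≤ N then 1 else -1

/-- The flat metric `g₀ = ∑_{i ≤ N - ν} dx_i² - ∑_{i > N - ν} dx_i²` of `ℝ^{N+1}_ν`. -/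
def pseudoEuclideanForm (N ν : ℕ) :
    EuclideanSpace ℝ (Fin (N + 1)) →L[ℝ] EuclideanSpace ℝ (Fin (N + 1)) →L[ℝ] ℝ :=
  ∑ i, pseudoSign N ν i • (ContinuousLinearMap.mul ℝ ℝ).bilinearComp
    (EuclideanSpace.proj i) (EuclideanSpace.proj i)

/-- The index of the pseudo-Euclidean space `𝔼^{N+1}_λ` around the space form: it is `λ` if `c = 1`
and `λ + 1` if `c = -1`. -/
def ambientIndex (l : ℕ) (c : ℤˣ) : ℕ := if c = 1 then l else l + 1

/-- The hyperquadric `{p ∈ 𝔼^{N+1}_λ : g₀(p, p) = c}`. -/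
@[ext]
structure Hyperquadric (N l : ℕ) (c : ℤˣ) where
  /-- The inclusion into the pseudo-Euclidean space. -/
  point : EuclideanSpace ℝ (Fin (N + 1))
  form_eq : pseudoEuclideanForm N (ambientIndex l c) point point = ((c : ℤ) : ℝ)

namespace Hyperquadric

variable {N l : ℕ} {c : ℤˣ}

/-- The subspace topology. -/
instance : TopologicalSpace (Hyperquadric N l c) := .induced point inferInstance

lemma isInducing_point : Topology.IsInducing (point : Hyperquadric N l c → _) := ⟨rfl⟩

lemma form_apply (N ν : ℕ) (p q : EuclideanSpace ℝ (Fin (N + 1))) :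
    pseudoEuclideanForm N ν p q = ∑ i, pseudoSign N ν i * (p i * q i) := by
  simp [pseudoEuclideanForm]

lemma sign_mul_self (N ν : ℕ) (i : Fin (N + 1)) : pseudoSign N ν i * pseudoSign N ν i = 1 := by
  unfold pseudoSign; split_ifs <;> norm_num

/-- The square of the `i`-th coordinate of a point of the hyperquadric, in terms of its other
coordinates `y`. -/
def sqCoord (l : ℕ) (c : ℤˣ) (i : Fin (N + 1)) (y : EuclideanSpace ℝ (Fin N)) : ℝ :=
  pseudoSign N (ambientIndex l c) i *
    (((c : ℤ) : ℝ) - ∑ j, pseudoSign N (ambientIndex l c) (i.succAbove j) * (y j * y j))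

/-- The point with `i`-th coordinate `σ * √(sqCoord y)` and other coordinates `y`. -/
def graphPoint (l : ℕ) (c : ℤˣ) (i : Fin (N + 1)) (σ : ℝ) (y : EuclideanSpace ℝ (Fin N)) :
    EuclideanSpace ℝ (Fin (N + 1)) :=
  WithLp.toLp 2 (i.insertNth (α := fun _ ↦ ℝ) (σ * √(sqCoord l c i y)) (fun j ↦ y j))

/-- Deleting the `i`-th coordinate. -/
def dropCoord (i : Fin (N + 1)) (p : EuclideanSpace ℝ (Fin (N + 1))) : EuclideanSpace ℝ (Fin N) :=
  WithLp.toLp 2 (fun j ↦ p (i.succAbove j))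

lemma contDiff_sqCoord (i : Fin (N + 1)) : ContDiff ℝ ∞ (sqCoord l c i) := by
  unfold sqCoord; fun_prop

lemma contDiff_dropCoord (i : Fin (N + 1)) : ContDiff ℝ ∞ (dropCoord i) := by
  unfold dropCoord; fun_prop

lemma continuous_graphPoint (i : Fin (N + 1)) (σ : ℝ) : Continuous (graphPoint l c i σ) := by
  have h := (contDiff_sqCoord (l := l) (c := c) i).continuous
  unfold graphPoint
  refine (PiLp.continuous_toLp 2 _).comp (continuous_pi fun k ↦ ?_)
  refine Fin.succAboveCases i ?_ (fun j ↦ ?_) k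
  · simp only [Fin.insertNth_apply_same]; fun_prop
  · simp only [Fin.insertNth_apply_succAbove]; fun_prop

lemma contDiffOn_graphPoint (i : Fin (N + 1)) (σ : ℝ) :
    ContDiffOn ℝ ∞ (graphPoint l c i σ) {y | 0 < sqCoord l c i y} := by
  have h := (contDiff_sqCoord (l := l) (c := c) i).contDiffOn (s := {y | 0 < sqCoord l c i y})
  rw [contDiffOn_euclidean]
  intro k
  unfold graphPoint
  refine Fin.succAboveCases i ?_ (fun j ↦ ?_) k
  · simp only [Fin.insertNth_apply_same]
    exact contDiffOn_const.mul (h.sqrt fun y hy ↦ (ne_of_gt hy))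
  · simp only [Fin.insertNth_apply_succAbove]; fun_prop

lemma graphPoint_mem (i : Fin (N + 1)) {σ : ℝ} (hσ : σ * σ = 1) {y : EuclideanSpace ℝ (Fin N)}
    (hy : 0 < sqCoord l c i y) :
    pseudoEuclideanForm N (ambientIndex l c) (graphPoint l c i σ y) (graphPoint l c i σ y)
      = ((c : ℤ) : ℝ) := by
  rw [form_apply, Fin.sum_univ_succAbove _ i]
  simp only [graphPoint, Fin.insertNth_apply_same, Fin.insertNth_apply_succAbove]
  have h1 : σ * √(sqCoord l c i y) * (σ * √(sqCoord l c i y)) = sqCoord l c i y := by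
    rw [mul_mul_mul_comm, hσ, one_mul, Real.mul_self_sqrt hy.le]
  rw [h1, sqCoord, ← mul_assoc, sign_mul_self]
  ring

lemma sqCoord_dropCoord (i : Fin (N + 1)) (p : Hyperquadric N l c) :
    sqCoord l c i (dropCoord i p.point) = p.point i * p.point i := by
  have h := p.form_eq
  rw [form_apply, Fin.sum_univ_succAbove _ i] at h
  simp only [sqCoord, dropCoord]
  rw [← h, add_sub_cancel_right, ← mul_assoc, sign_mul_self, one_mul]

lemma exists_coord_ne_zero (p : Hyperquadric N l c) : ∃ i, p.point i ≠ 0 := by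
  by_contra! h
  have h2 := p.form_eq
  rw [form_apply] at h2
  simp [h] at h2
  rcases Int.units_eq_one_or c with rfl | rfl <;> norm_num at h2

lemma sqCoord_pos (i : Fin (N + 1)) {σ : ℝ} {p : Hyperquadric N l c} (hp : 0 < σ * p.point i) :
    0 < sqCoord l c i (dropCoord i p.point) := by
  rw [sqCoord_dropCoord]
  exact mul_self_pos.2 (right_ne_zero_of_mul hp.ne')

open Classical in
/-- The inverse of the chart below (with the junk value `p₀` outside its target). -/
def ofGraph (p₀ : Hyperquadric N l c) (i : Fin (N + 1)) (σ : ℝ) (hσ : σ * σ = 1)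
    (y : EuclideanSpace ℝ (Fin N)) : Hyperquadric N l c :=
  if hy : 0 < sqCoord l c i y then ⟨graphPoint l c i σ y, graphPoint_mem i hσ hy⟩ else p₀

lemma ofGraph_point (p₀ : Hyperquadric N l c) (i : Fin (N + 1)) (σ : ℝ) (hσ : σ * σ = 1)
    {y : EuclideanSpace ℝ (Fin N)} (hy : 0 < sqCoord l c i y) :
    (ofGraph p₀ i σ hσ y).point = graphPoint l c i σ y := by
  rw [ofGraph, dif_pos hy]

/-- The chart deleting the `i`-th coordinate, on the part of the hyperquadric where the `i`-th
coordinate has the sign `σ = ±1`. -/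
def chart (p₀ : Hyperquadric N l c) (i : Fin (N + 1)) (σ : ℝ) (hσ : σ * σ = 1) :
    OpenPartialHomeomorph (Hyperquadric N l c) (EuclideanSpace ℝ (Fin N)) where
  toFun p := dropCoord i p.point
  invFun := ofGraph p₀ i σ hσ
  source := {p | 0 < σ * p.point i}
  target := {y | 0 < sqCoord l c i y}
  map_source' _ hp := sqCoord_pos i hp
  map_target' y hy := by
    show 0 < σ * (ofGraph p₀ i σ hσ y).point i
    have h : graphPoint l c i σ y i = σ * √(sqCoord l c i y) := by simp [graphPoint]
    rw [ofGraph_point p₀ i σ hσ hy, h, ← mul_assoc, hσ, one_mul]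
    exact Real.sqrt_pos.2 hy
  left_inv' p hp := by
    have hp : 0 < σ * p.point i := hp
    refine Hyperquadric.ext ?_
    rw [ofGraph_point p₀ i σ hσ (sqCoord_pos i hp)]
    ext k
    simp only [graphPoint, sqCoord_dropCoord]
    refine Fin.succAboveCases i ?_ (fun j ↦ ?_) k
    · simp only [Fin.insertNth_apply_same]
      have : p.point i * p.point i = (σ * p.point i) * (σ * p.point i) := by
        rw [mul_mul_mul_comm, hσ, one_mul]
      rw [this, Real.sqrt_mul_self hp.le, ← mul_assoc, hσ, one_mul]
    · simp only [Fin.insertNth_apply_succAbove, dropCoord]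
  right_inv' y hy := by
    show dropCoord i (ofGraph p₀ i σ hσ y).point = y
    rw [ofGraph_point p₀ i σ hσ hy]
    ext j
    simp [dropCoord, graphPoint]
  open_source := by
    refine isOpen_lt continuous_const (continuous_const.mul ?_)
    exact (EuclideanSpace.proj (𝕜 := ℝ) i).continuous.comp isInducing_point.continuous
  open_target := isOpen_lt continuous_const (contDiff_sqCoord i).continuous
  continuousOn_toFun :=
    ((contDiff_dropCoord i).continuous.comp isInducing_point.continuous).continuousOn
  continuousOn_invFun :=
    isInducing_point.continuousOn_iff.2 <|
      (continuous_graphPoint (l := l) (c := c) i σ).continuousOn.congr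
        fun _ hy ↦ ofGraph_point p₀ i σ hσ hy

/-- The smooth structure of the hyperquadric, as a graph over its coordinate hyperplanes. -/
instance : ChartedSpace (EuclideanSpace ℝ (Fin N)) (Hyperquadric N l c) where
  atlas := {e | ∃ (p₀ : Hyperquadric N l c) (i : Fin (N + 1)) (σ : ℝ) (hσ : σ * σ = 1),
    e = chart p₀ i σ hσ}
  chartAt p := chart p (exists_coord_ne_zero p).choose
    (SignType.sign (p.point (exists_coord_ne_zero p).choose)) (by
      have := (exists_coord_ne_zero p).choose_spec
      rcases lt_or_gt_of_ne this with h | h <;> simp [h])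
  mem_chart_source p := by
    have := (exists_coord_ne_zero p).choose_spec
    show 0 < (SignType.sign (p.point (exists_coord_ne_zero p).choose) : ℝ)
      * p.point (exists_coord_ne_zero p).choose
    rw [_root_.sign_mul_self]
    exact abs_pos.2 this
  chart_mem_atlas p := ⟨_, _, _, _, rfl⟩

instance : IsManifold (𝓡 N) ∞ (Hyperquadric N l c) := by
  refine isManifold_of_contDiffOn _ _ _ ?_
  rintro _ _ ⟨p, i, σ, hσ, rfl⟩ ⟨p', i', σ', hσ', rfl⟩
  have h := (contDiff_dropCoord (N := N) i').comp_contDiffOn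
    (contDiffOn_graphPoint (l := l) (c := c) i σ)
  refine (h.mono ?_).congr ?_
  · rintro y ⟨hy, -⟩
    exact hy.1
  · rintro y ⟨hy, -⟩
    exact congrArg (dropCoord i') (ofGraph_point p i σ hσ hy.1)

instance : LocallyConnectedSpace (Hyperquadric N l c) :=
  ChartedSpace.locallyConnectedSpace (EuclideanSpace ℝ (Fin N)) _

end Hyperquadric

/-- The space form `𝕄^N_λ(c)`: the connected component of `p₀` in the hyperquadric. -/
def spaceForm {N l : ℕ} {c : ℤˣ} (p₀ : Hyperquadric N l c) :
    TopologicalSpace.Opens (Hyperquadric N l c) :=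
  ⟨connectedComponent p₀, isOpen_connectedComponent⟩

end SpaceForm

/-! ### The warped product `εI ×_a 𝕄^N_λ(c)` -/

section WarpedProduct

variable {N l : ℕ} {c : ℤˣ}

/-- The warped product metric `ε dt² + a(t)² g` on `I × 𝕄^N_λ(c)`, where `g` is the metric induced
on `𝕄^N_λ(c)` by the flat metric `g₀` of the surrounding pseudo-Euclidean space. -/
def warpedMetric (ε : ℤˣ) (I : TopologicalSpace.Opens ℝ) (a : ℝ → ℝ) (p₀ : Hyperquadric N l c)
    (p : I × spaceForm p₀) :
    TangentSpace (𝓘(ℝ, ℝ).prod (𝓡 N)) p →L[ℝ] TangentSpace (𝓘(ℝ, ℝ).prod (𝓡 N)) p →L[ℝ] ℝ :=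
  let dt : TangentSpace (𝓘(ℝ, ℝ).prod (𝓡 N)) p →L[ℝ] ℝ :=
    mvfderiv (𝓘(ℝ, ℝ).prod (𝓡 N)) (fun q : I × spaceForm p₀ ↦ (q.1 : ℝ)) p
  let dΞ : TangentSpace (𝓘(ℝ, ℝ).prod (𝓡 N)) p →L[ℝ] EuclideanSpace ℝ (Fin (N + 1)) :=
    mvfderiv (𝓘(ℝ, ℝ).prod (𝓡 N)) (fun q : I × spaceForm p₀ ↦ q.2.1.point) p
  ((ε : ℤ) : ℝ) • (dt.precomp ℝ).comp ((ContinuousLinearMap.mul ℝ ℝ).comp dt)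
    + a p.1 ^ 2 • (dΞ.precomp ℝ).comp ((pseudoEuclideanForm N (ambientIndex l c)).comp dΞ)

end WarpedProduct

end

/-! The warped product is studied inside the vector space `W = ℝ × ℝ^{N+1}`, through `Φ = (t, ξ)`.
Its tangent spaces are the kernels of `θ(τ, v) = B(ξ, v)`, where `B` is the flat form, and its
metric is induced by `G = ε dt² + a² B`. Its Levi-Civita connection is induced by `D + S`, with `D`
the flat derivative and `S((τ, v), (τ', v')) = (-ε a a' B(v, v'), (a'/a)(τ v' + τ' v) + c B(v, v')
ξ)`: the warping terms, plus the correction that keeps `D` tangent to the quadric. Indeed `D + S` is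
torsion-free, compatible with `G` on tangent vectors and preserves tangency, and the Koszul formula
leaves no other choice (`IsAmbientModel.fderiv_inChart_christoffel`, `isAmbientModel_warped`).

Consequently `dΦ(∇_u V) = u(dΦ V) + S(d(Φ ∘ f) u, dΦ V)` for every field `V` along `f` with `dΦ V`
differentiable (`IsAmbientModel.mvfderiv_covDerivAlong`). Identities between fields along `f` become
identities between `W`-valued functions, and injectivity of `dΦ` brings them back. In particular
`dΦ` carries the curvature of `∇`, computed along `f` or on `P`, to the algebraic curvature of `D +
S` (`IsAmbientModel.ambient_curvature_along`, `IsAmbientModel.ambient_curvatureTensor`).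

For `u`, `v` tangent to `M` and `z` normal to `M`, every curvature term containing `⟨u, z⟩` or `⟨v,
z⟩` drops out. What remains is a multiple of `dt(u) v - dt(v) u` (`connectionCurvature_warped`),
which is tangent to `M`; hence the ambient term of the Ricci equation vanishes.

The Ricci equation itself comes from `∇_Y η = ∇^⊥_Y η - df(A_η Y)`: differentiating once more and
taking normal parts, the tangential summand contributes `α(A_η Y, X)`
(`IsAmbientModel.normalCurvature_eq`). -/

noncomputable section

/-! ### Calculus of vector-valued functions on a manifold. -/

section VectorValuedDerivative

open scoped Topology

variable {E : Type*} [NormedAddCommGroup E] [NormedSpace ℝ E]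
  {H : Type*} [TopologicalSpace H] {I : ModelWithCorners ℝ E H}
  {M : Type*} [TopologicalSpace M] [ChartedSpace H M]
  {W : Type*} [NormedAddCommGroup W] [NormedSpace ℝ W]
  {W' : Type*} [NormedAddCommGroup W'] [NormedSpace ℝ W']
  {W'' : Type*} [NormedAddCommGroup W''] [NormedSpace ℝ W'']

/-- The base point is a separate variable `y`, so that the chain rule applies when `h x` is known in
another form, as with `Φ` read in a chart. -/
theorem mvfderiv_fderiv_comp {h : M → W} {x : M} {Ψ : W → W'} {y : W} (hy : h x = y)
    (hΨ : DifferentiableAt ℝ Ψ y) (hh : MDifferentiableAt I 𝓘(ℝ, W) h x) (u : TangentSpace I x) :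
    mvfderiv I (fun x' ↦ Ψ (h x')) x u = fderiv ℝ Ψ y (mvfderiv I h x u) := by
  subst hy
  have := mfderiv_comp_apply x hΨ.mdifferentiableAt hh u
  rw [mfderiv_eq_fderiv] at this
  exact this

theorem mdifferentiableAt_comp_vector {h : M → W} {x : M} {Ψ : W → W'} {y : W} (hy : h x = y)
    (hΨ : DifferentiableAt ℝ Ψ y) (hh : MDifferentiableAt I 𝓘(ℝ, W) h x) :
    MDifferentiableAt I 𝓘(ℝ, W') (fun x' ↦ Ψ (h x')) x := by
  subst hy
  exact hΨ.mdifferentiableAt.comp x hh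

theorem mvfderiv_congr {h h' : M → W} {x : M} (hh : h =ᶠ[𝓝 x] h') :
    mvfderiv I h x = mvfderiv I h' x := by
  ext u
  have := hh.mfderiv_eq (I := I) (I' := 𝓘(ℝ, W))
  exact congrArg (fun L : E →L[ℝ] W ↦ L u) this

theorem mvfderiv_prodMk {h : M → W} {k : M → W'} {x : M}
    (hh : MDifferentiableAt I 𝓘(ℝ, W) h x) (hk : MDifferentiableAt I 𝓘(ℝ, W') k x)
    (u : TangentSpace I x) :
    mvfderiv I (fun x' ↦ (h x', k x')) x u = (mvfderiv I h x u, mvfderiv I k x u) := by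
  have hp := hh.prodMk_space hk
  refine Prod.ext ?_ ?_
  · have := mvfderiv_fderiv_comp (Ψ := (Prod.fst : W × W' → W)) rfl differentiableAt_fst hp u
    rw [fderiv_fst] at this
    exact this.symm
  · have := mvfderiv_fderiv_comp (Ψ := (Prod.snd : W × W' → W')) rfl differentiableAt_snd hp u
    rw [fderiv_snd] at this
    exact this.symm

theorem mvfderiv_clm_apply {k : M → W →L[ℝ] W'} {h : M → W} {x : M}
    (hk : MDifferentiableAt I 𝓘(ℝ, W →L[ℝ] W') k x) (hh : MDifferentiableAt I 𝓘(ℝ, W) h x)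
    (u : TangentSpace I x) :
    mvfderiv I (fun x' ↦ k x' (h x')) x u = mvfderiv I k x u (h x) + k x (mvfderiv I h x u) := by
  have h1 := hk.prodMk_space hh
  have h2 := (isBoundedBilinearMap_apply (𝕜 := ℝ) (E := W) (F := W')).hasFDerivAt (k x, h x)
  rw [mvfderiv_fderiv_comp (Ψ := fun p : (W →L[ℝ] W') × W ↦ p.1 p.2) (h := fun x' ↦ (k x', h x'))
    rfl h2.differentiableAt h1, h2.fderiv, mvfderiv_prodMk hk hh]
  exact add_comm _ _

end VectorValuedDerivative

/-! ### Differentials of vector-valued maps, read in a chart. -/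

section Charts

open scoped Topology

variable {E : Type*} [NormedAddCommGroup E] [NormedSpace ℝ E]
  {H : Type*} [TopologicalSpace H] {I : ModelWithCorners ℝ E H}
  {M : Type*} [TopologicalSpace M] [ChartedSpace H M] [IsManifold I ∞ M]
  {F : Type*} [NormedAddCommGroup F] [NormedSpace ℝ F]
  {K : Type*} [TopologicalSpace K] {J : ModelWithCorners ℝ F K}
  {P : Type*} [TopologicalSpace P] [ChartedSpace K P] [IsManifold J ∞ P]
  {W : Type*} [NormedAddCommGroup W] [NormedSpace ℝ W]

variable (J) in
/-- The map `Φ` read in the preferred chart of its source around `p`. -/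
def inChart (Φ : P → W) (p : P) : F → W := Φ ∘ (extChartAt J p).symm

theorem contDiffAt_inChart [J.Boundaryless] {Φ : P → W} (p : P) {q : P}
    (hq : q ∈ (chartAt K p).source) (hΦ : ContMDiffAt J 𝓘(ℝ, W) ∞ Φ q) :
    ContDiffAt ℝ ∞ (inChart J Φ p) (extChartAt J p q) := by
  have hq' : q ∈ (extChartAt J p).source := by rwa [extChartAt_source]
  have h1 := (contMDiffOn_extChartAt_symm (I := J) (n := ∞) p).contMDiffAt
    ((isOpen_extChartAt_target p).mem_nhds ((extChartAt J p).map_source hq'))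
  refine contMDiffAt_iff_contDiffAt.1 (ContMDiffAt.comp (extChartAt J p q) ?_ h1)
  rwa [(extChartAt J p).left_inv hq']

/-- The trivialization around `p` is the differential of the chart around `p`, so this is the chain
rule for `Φ = inChart J Φ p ∘ extChartAt J p`. It is needed for all `q` near `p`, because components
are differentiated. -/
theorem mvfderiv_eq_fderiv_inChart [J.Boundaryless] {Φ : P → W} (p : P) {q : P}
    (hΦ : ContMDiffAt J 𝓘(ℝ, W) ∞ Φ q) (hq : q ∈ (chartAt K p).source) (v : TangentSpace J q) :
    mvfderiv J Φ q v = fderiv ℝ (inChart J Φ p) (extChartAt J p q)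
      (trivializationAt F (TangentSpace J) p (⟨q, v⟩ : TangentBundle J P)).2 := by
  have hq' : q ∈ (extChartAt J p).source := by rwa [extChartAt_source]
  have h1 : Φ =ᶠ[𝓝 q] fun q' ↦ inChart J Φ p (extChartAt J p q') := by
    filter_upwards [(isOpen_extChartAt_source (I := J) p).mem_nhds hq'] with q' h
    exact (congrArg Φ ((extChartAt J p).left_inv h)).symm
  have hd := (contDiffAt_inChart p hq hΦ).differentiableAt (by simp)
  rw [mvfderiv_congr h1, mvfderiv_fderiv_comp rfl hd (mdifferentiableAt_extChartAt hq)]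
  congr 1
  have h2 := TangentBundle.continuousLinearMapAt_trivializationAt (I := J) hq
  rw [← Trivialization.continuousLinearMapAt_apply_of_mem (R := ℝ) _ (by exact hq), h2]
  rfl

theorem mvfderiv_eq_fderiv_inChart_self [J.Boundaryless] {Φ : P → W} {p : P}
    (hΦ : ContMDiffAt J 𝓘(ℝ, W) ∞ Φ p) (v : TangentSpace J p) :
    mvfderiv J Φ p v = fderiv ℝ (inChart J Φ p) (extChartAt J p p) v := by
  rw [mvfderiv_eq_fderiv_inChart p hΦ (mem_chart_source K p)]
  congr 1
  have h2 := TangentBundle.continuousLinearMapAt_trivializationAt (I := J) (mem_chart_source K p)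
  rw [← Trivialization.continuousLinearMapAt_apply_of_mem (R := ℝ) _
    (by exact mem_chart_source K p), h2, mfderiv_extChartAt_self]
  rfl

theorem fderiv_inChart_eq_mvfderiv [J.Boundaryless] {Φ : P → W} (p : P) {y : F}
    (hΦ : ContMDiffAt J 𝓘(ℝ, W) ∞ Φ ((extChartAt J p).symm y))
    (hy : y ∈ (extChartAt J p).target) (v : F) :
    fderiv ℝ (inChart J Φ p) y v = mvfderiv J Φ ((extChartAt J p).symm y)
      ((trivializationAt F (TangentSpace J) p).symmL ℝ ((extChartAt J p).symm y) v) := by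
  have hq : (extChartAt J p).symm y ∈ (chartAt K p).source := by
    rw [← extChartAt_source J]; exact (extChartAt J p).map_target hy
  rw [mvfderiv_eq_fderiv_inChart p hΦ hq, (extChartAt J p).right_inv hy]
  congr 1
  rw [← Trivialization.continuousLinearMapAt_apply_of_mem (R := ℝ) _ (by exact hq)]
  exact (Trivialization.continuousLinearMapAt_symmL (R := ℝ) _ (by exact hq) v).symm

end Charts

/-! ### Differentiable dependence of solutions of linear equations. -/

section DifferentiableSolution

open scoped Topology

variable {E : Type*} [NormedAddCommGroup E] [NormedSpace ℝ E]
  {H : Type*} [TopologicalSpace H] {I : ModelWithCorners ℝ E H}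
  {M : Type*} [TopologicalSpace M] [ChartedSpace H M]
  {F : Type*} [NormedAddCommGroup F] [NormedSpace ℝ F] [FiniteDimensional ℝ F]
  {W : Type*} [NormedAddCommGroup W] [NormedSpace ℝ W] [FiniteDimensional ℝ W]

/-- The solution `c` of a linear equation `k c = b` with `k` injective is differentiable as soon as
`k` and `b` are. -/
theorem MDifferentiableAt.of_clm_apply {k : M → F →L[ℝ] W} {c : M → F} {b : M → W} {x : M}
    (hk : MDifferentiableAt I 𝓘(ℝ, F →L[ℝ] W) k x) (hinj : ∀ v, k x v = 0 → v = 0)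
    (hb : MDifferentiableAt I 𝓘(ℝ, W) b x) (hc : ∀ᶠ x' in 𝓝 x, k x' (c x') = b x') :
    MDifferentiableAt I 𝓘(ℝ, F) c x := by
  -- One fixed left inverse `L` of `k x` suffices: `L ∘ k` is the identity at `x`, hence invertible
  -- nearby, and there `c = (L ∘ k)⁻¹ (L b)`.
  obtain ⟨L₀, hL₀⟩ := LinearMap.exists_leftInverse_of_injective (k x : F →ₗ[ℝ] W)
    (LinearMap.ker_eq_bot'.2 hinj)
  set L : W →L[ℝ] F := LinearMap.toContinuousLinearMap L₀
  have : CompleteSpace F := FiniteDimensional.complete ℝ F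
  have hLk : L.comp (k x) = 1 := by
    ext v
    exact LinearMap.congr_fun hL₀ v
  have hB : MDifferentiableAt I 𝓘(ℝ, F →L[ℝ] F) (fun x' ↦ L.comp (k x')) x :=
    mdifferentiableAt_comp_vector (Ψ := fun T : F →L[ℝ] W ↦ L.comp T) rfl
      ((ContinuousLinearMap.compL ℝ F W F L).differentiableAt) hk
  have hBi : MDifferentiableAt I 𝓘(ℝ, F →L[ℝ] F) (fun x' ↦ Ring.inverse (L.comp (k x'))) x :=
    mdifferentiableAt_comp_vector (Ψ := Ring.inverse) (y := ((1 : (F →L[ℝ] F)ˣ) : F →L[ℝ] F))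
      hLk (differentiableAt_inverse ⟨1, rfl⟩) hB
  have hLb : MDifferentiableAt I 𝓘(ℝ, F) (fun x' ↦ L (b x')) x :=
    mdifferentiableAt_comp_vector rfl L.differentiableAt hb
  refine (hBi.clm_apply hLb).congr_of_eventuallyEq ?_
  have hunit : ∀ᶠ x' in 𝓝 x, IsUnit (L.comp (k x')) := by
    refine hB.continuousAt.eventually ?_
    have : (fun x' ↦ L.comp (k x')) x = ((1 : (F →L[ℝ] F)ˣ) : F →L[ℝ] F) := hLk
    rw [this]
    exact Units.nhds 1
  filter_upwards [hunit, hc] with x' h1 h2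
  rw [← h2]
  exact (congrArg (fun T : F →L[ℝ] F ↦ T (c x')) (Ring.inverse_mul_cancel _ h1)).symm

end DifferentiableSolution

/-! ### Vector fields along a map and their components. -/

section AlongMap

set_option linter.unusedSectionVars false

open scoped Topology

variable {E : Type*} [NormedAddCommGroup E] [NormedSpace ℝ E]
  {H : Type*} [TopologicalSpace H] {I : ModelWithCorners ℝ E H}
  {M : Type*} [TopologicalSpace M] [ChartedSpace H M]
  {F : Type*} [NormedAddCommGroup F] [NormedSpace ℝ F]
  {K : Type*} [TopologicalSpace K] {J : ModelWithCorners ℝ F K}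
  {P : Type*} [TopologicalSpace P] [ChartedSpace K P] [IsManifold J ∞ P]
  {W : Type*} [NormedAddCommGroup W] [NormedSpace ℝ W]

variable (J) in
/-- The components, in the preferred chart around `p`, of the vector field `V` along `f`. -/
def compAlong {f : M → P} (p : P) (V : Π x : M, TangentSpace J (f x)) (x : M) : F :=
  (trivializationAt F (TangentSpace J) p (⟨f x, V x⟩ : TangentBundle J P)).2

variable {f : M → P} {V : Π x : M, TangentSpace J (f x)} {Φ : P → W} {x : M}

theorem compAlong_self : compAlong J (f x) V x = V x := by
  have h2 := TangentBundle.continuousLinearMapAt_trivializationAt (I := J)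
    (mem_chart_source K (f x))
  rw [compAlong, ← Trivialization.continuousLinearMapAt_apply_of_mem (R := ℝ) _
    (by exact mem_chart_source K (f x)), h2, mfderiv_extChartAt_self]
  rfl

/-- Near `x`, `dΦ(V)` is a differentiable matrix applied to the components of `V`. Read one way this
allows the product rule; read the other way it is a linear system for the components. -/
theorem eventually_mvfderiv_along_eq [J.Boundaryless]
    (hΦ : ∀ᶠ q in 𝓝 (f x), ContMDiffAt J 𝓘(ℝ, W) ∞ Φ q) (hf : ContinuousAt f x) :
    ∀ᶠ x' in 𝓝 x, fderiv ℝ (inChart J Φ (f x)) (extChartAt J (f x) (f x'))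
      (compAlong J (f x) V x') = mvfderiv J Φ (f x') (V x') := by
  filter_upwards [hf.eventually ((chartAt K (f x)).open_source.mem_nhds
    (mem_chart_source K (f x))), hf.eventually hΦ] with x' hx' hΦ'
  exact (mvfderiv_eq_fderiv_inChart (f x) hΦ' hx' (V x')).symm

theorem mdifferentiableAt_extChartAt_comp (hf : MDifferentiableAt I J f x) :
    MDifferentiableAt I 𝓘(ℝ, F) (fun x' ↦ extChartAt J (f x) (f x')) x :=
  (mdifferentiableAt_extChartAt (mem_chart_source K (f x))).comp x hf

theorem mvfderiv_extChartAt_comp (hf : MDifferentiableAt I J f x) (u : TangentSpace I x) :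
    mvfderiv I (fun x' ↦ extChartAt J (f x) (f x')) x u = mfderiv I J f x u := by
  have h := mfderiv_comp_apply x (mdifferentiableAt_extChartAt (I := J)
    (mem_chart_source K (f x))) hf u
  rw [mfderiv_extChartAt_self] at h
  exact h

theorem differentiableAt_fderiv_inChart [J.Boundaryless] {p : P}
    (hΦ : ContMDiffAt J 𝓘(ℝ, W) ∞ Φ p) :
    DifferentiableAt ℝ (fderiv ℝ (inChart J Φ p)) (extChartAt J p p) :=
  ((contDiffAt_inChart p (mem_chart_source K p) hΦ).fderiv_right (m := 1) (WithTop.coe_le_coe.2 le_top)).differentiableAt (by simp)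

theorem mdifferentiableAt_fderiv_inChart_comp [J.Boundaryless]
    (hΦ : ContMDiffAt J 𝓘(ℝ, W) ∞ Φ (f x))
    (hf : MDifferentiableAt I J f x) :
    MDifferentiableAt I 𝓘(ℝ, F →L[ℝ] W)
      (fun x' ↦ fderiv ℝ (inChart J Φ (f x)) (extChartAt J (f x) (f x'))) x :=
  mdifferentiableAt_comp_vector rfl (differentiableAt_fderiv_inChart hΦ)
    (mdifferentiableAt_extChartAt_comp hf)

/-- The components of `V` solve a linear system whose matrix is injective at `x`, so
differentiability can be tested on the `W`-valued function `dΦ(V)`. -/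
theorem mdifferentiableAt_compAlong [J.Boundaryless] [FiniteDimensional ℝ F] [FiniteDimensional ℝ W]
    (hΦ : ∀ᶠ q in 𝓝 (f x), ContMDiffAt J 𝓘(ℝ, W) ∞ Φ q) (hf : MDifferentiableAt I J f x)
    (hinj : ∀ v, mvfderiv J Φ (f x) v = 0 → v = 0)
    (hV : MDifferentiableAt I 𝓘(ℝ, W) (fun x' ↦ mvfderiv J Φ (f x') (V x')) x) :
    MDifferentiableAt I 𝓘(ℝ, F) (compAlong J (f x) V) x := by
  refine MDifferentiableAt.of_clm_apply (mdifferentiableAt_fderiv_inChart_comp hΦ.self_of_nhds hf) ?_ hV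
    (eventually_mvfderiv_along_eq hΦ hf.continuousAt)
  intro v hv
  exact hinj v ((mvfderiv_eq_fderiv_inChart_self hΦ.self_of_nhds v).trans hv)

/-- The derivative of `dΦ(V)` for a vector field `V` along `f`. -/
theorem mvfderiv_mvfderiv_along [J.Boundaryless] (hΦ : ∀ᶠ q in 𝓝 (f x), ContMDiffAt J 𝓘(ℝ, W) ∞ Φ q) (hf : MDifferentiableAt I J f x)
    (hV : MDifferentiableAt I 𝓘(ℝ, F) (compAlong J (f x) V) x) (u : TangentSpace I x) :
    mvfderiv I (fun x' ↦ mvfderiv J Φ (f x') (V x')) x u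
      = fderiv ℝ (fderiv ℝ (inChart J Φ (f x))) (extChartAt J (f x) (f x))
          (mfderiv I J f x u) (V x)
        + mvfderiv J Φ (f x) (mvfderiv I (compAlong J (f x) V) x u) := by
  rw [← mvfderiv_congr (eventually_mvfderiv_along_eq hΦ hf.continuousAt)]
  refine (mvfderiv_clm_apply (mdifferentiableAt_fderiv_inChart_comp hΦ.self_of_nhds hf) hV u).trans ?_
  rw [mvfderiv_fderiv_comp (h := fun x' ↦ extChartAt J (f x) (f x')) rfl
    (differentiableAt_fderiv_inChart hΦ.self_of_nhds) (mdifferentiableAt_extChartAt_comp hf), mvfderiv_extChartAt_comp hf,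
    compAlong_self]
  exact congrArg _ (mvfderiv_eq_fderiv_inChart_self hΦ.self_of_nhds _).symm

theorem mdifferentiableAt_mvfderiv_along [J.Boundaryless] (hΦ : ∀ᶠ q in 𝓝 (f x), ContMDiffAt J 𝓘(ℝ, W) ∞ Φ q)
    (hf : MDifferentiableAt I J f x)
    (hV : MDifferentiableAt I 𝓘(ℝ, F) (compAlong J (f x) V) x) :
    MDifferentiableAt I 𝓘(ℝ, W) (fun x' ↦ mvfderiv J Φ (f x') (V x')) x := by
  refine (MDifferentiableAt.clm_apply (mdifferentiableAt_fderiv_inChart_comp hΦ.self_of_nhds hf)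
    hV).congr_of_eventuallyEq ?_
  filter_upwards [eventually_mvfderiv_along_eq (V := V) hΦ hf.continuousAt] with x' h
  exact h.symm

theorem contMDiffAt_mvfderiv_along [J.Boundaryless]
    (hΦ : ∀ᶠ q in 𝓝 (f x), ContMDiffAt J 𝓘(ℝ, W) ∞ Φ q)
    (hV : ContMDiffAt I J.tangent ∞ (fun x' ↦ (⟨f x', V x'⟩ : TangentBundle J P)) x) :
    ContMDiffAt I 𝓘(ℝ, W) ∞ (fun x' ↦ mvfderiv J Φ (f x') (V x')) x := by
  obtain ⟨hf, hV'⟩ := contMDiffAt_totalSpace.1 hV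
  have hφ : ContMDiffAt I 𝓘(ℝ, F) ∞ (fun x' ↦ extChartAt J (f x) (f x')) x :=
    contMDiffAt_extChartAt.comp x hf
  have hA : ContMDiffAt I 𝓘(ℝ, F →L[ℝ] W) ∞
      (fun x' ↦ fderiv ℝ (inChart J Φ (f x)) (extChartAt J (f x) (f x'))) x :=
    ContDiffAt.comp_contMDiffAt (g := fderiv ℝ (inChart J Φ (f x)))
      ((contDiffAt_inChart (f x) (mem_chart_source K (f x)) hΦ.self_of_nhds).fderiv_right le_rfl) hφ
  refine (hA.clm_apply hV').congr_of_eventuallyEq ?_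
  filter_upwards [eventually_mvfderiv_along_eq (V := V) hΦ hf.continuousAt] with x' h
  exact h.symm

end AlongMap

/-! ### The Levi-Civita connection induced from an ambient vector space. -/

section AmbientModel

set_option linter.unusedSectionVars false
set_option synthInstance.maxHeartbeats 200000

open scoped Topology

variable {E : Type*} [NormedAddCommGroup E] [NormedSpace ℝ E]
  {H : Type*} [TopologicalSpace H] {I : ModelWithCorners ℝ E H}
  {M : Type*} [TopologicalSpace M] [ChartedSpace H M]
  {F : Type*} [NormedAddCommGroup F] [NormedSpace ℝ F]
  {K : Type*} [TopologicalSpace K] {J : ModelWithCorners ℝ F K}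
  {P : Type*} [TopologicalSpace P] [ChartedSpace K P] [IsManifold J ∞ P]
  {W : Type*} [NormedAddCommGroup W] [NormedSpace ℝ W]

variable (J) in
/-- `Φ` is an immersion of `(P, g)` in a vector space `W`, whose tangent spaces are the kernels of
the `1`-form `θ`. The metric `g` is induced by the bilinear forms `G`, and along `Φ` the connection
`D + S` of `W` is torsion-free, compatible with `G`, and preserves tangency to `Φ`. -/
structure IsAmbientModel
    (g : Π p : P, TangentSpace J p →L[ℝ] TangentSpace J p →L[ℝ] ℝ) (Φ : P → W)
    (G : W → W →L[ℝ] W →L[ℝ] ℝ) (θ : W → W →L[ℝ] ℝ) (S : W → W →L[ℝ] W →L[ℝ] W) : Prop where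
  contMDiff : ContMDiff J 𝓘(ℝ, W) ∞ Φ
  injective : ∀ (p : P) (u : TangentSpace J p), mvfderiv J Φ p u = 0 → u = 0
  metric_eq : ∀ (p : P) (u v : TangentSpace J p),
    g p u v = G (Φ p) (mvfderiv J Φ p u) (mvfderiv J Φ p v)
  nondegenerate : ∀ (p : P) (u : TangentSpace J p), (∀ v, g p u v = 0) → u = 0
  form_tangent : ∀ (p : P) (u : TangentSpace J p), θ (Φ p) (mvfderiv J Φ p u) = 0
  exists_tangent : ∀ (p : P) (z : W), θ (Φ p) z = 0 → ∃ u, mvfderiv J Φ p u = z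
  contDiffAt_metric : ∀ p : P, ContDiffAt ℝ ∞ G (Φ p)
  contDiffAt_form : ∀ p : P, ContDiffAt ℝ ∞ θ (Φ p)
  contDiffAt_connection : ∀ p : P, ContDiffAt ℝ ∞ S (Φ p)
  metric_symm : ∀ w z z', G w z z' = G w z' z
  connection_symm : ∀ w z z', S w z z' = S w z' z
  metric_compatible : ∀ (p : P) (z₁ z₂ z₃ : W), θ (Φ p) z₁ = 0 → θ (Φ p) z₂ = 0 →
    θ (Φ p) z₃ = 0 →
    fderiv ℝ G (Φ p) z₁ z₂ z₃ = G (Φ p) (S (Φ p) z₁ z₂) z₃ + G (Φ p) z₂ (S (Φ p) z₁ z₃)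
  tangent_compatible : ∀ (p : P) (z₁ z₂ : W), θ (Φ p) z₁ = 0 → θ (Φ p) z₂ = 0 →
    θ (Φ p) (S (Φ p) z₁ z₂) = fderiv ℝ θ (Φ p) z₁ z₂

/-- A finite-dimensional space and its dual have equal dimension. This is needed because
`ContinuousLinearMap.inverse`, used for Christoffel symbols and tangential parts, is zero on
non-invertible maps. -/
theorem isInvertible_of_forall_eq_zero [FiniteDimensional ℝ F] {m : F →L[ℝ] F →L[ℝ] ℝ}
    (hm : ∀ a, m a = 0 → a = 0) : m.IsInvertible := by
  have hfr : Module.finrank ℝ F = Module.finrank ℝ (F →L[ℝ] ℝ) := by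
    rw [← (LinearMap.toContinuousLinearMap (𝕜 := ℝ) (E := F) (F' := ℝ)).finrank_eq]
    exact (Subspace.dual_finrank_eq (K := ℝ) (V := F)).symm
  exact ⟨(LinearEquiv.ofInjectiveOfFinrankEq (m : F →ₗ[ℝ] (F →L[ℝ] ℝ))
    ((injective_iff_map_eq_zero m).2 hm) hfr).toContinuousLinearEquiv, by ext; rfl⟩

theorem fderiv_comp_apply_of_eq {X : Type*} [NormedAddCommGroup X] [NormedSpace ℝ X]
    {W' : Type*} [NormedAddCommGroup W'] [NormedSpace ℝ W'] {Ψ : W → W'} {b : X → W} {y : X} {w : W}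
    (hw : b y = w) (hΨ : DifferentiableAt ℝ Ψ w) (hb : DifferentiableAt ℝ b y) (u : X) :
    fderiv ℝ (fun y' ↦ Ψ (b y')) y u = fderiv ℝ Ψ w (fderiv ℝ b y u) := by
  subst hw
  exact congrArg (fun L : X →L[ℝ] W' ↦ L u) (fderiv_comp y hΨ hb)

theorem differentiableAt_comp_of_eq {X : Type*} [NormedAddCommGroup X] [NormedSpace ℝ X]
    {W' : Type*} [NormedAddCommGroup W'] [NormedSpace ℝ W'] {Ψ : W → W'} {b : X → W} {y : X} {w : W}
    (hw : b y = w) (hΨ : DifferentiableAt ℝ Ψ w) (hb : DifferentiableAt ℝ b y) :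
    DifferentiableAt ℝ (fun y' ↦ Ψ (b y')) y := by
  subst hw
  exact hΨ.comp y hb

theorem fderiv_bilin_apply {X : Type*} [NormedAddCommGroup X] [NormedSpace ℝ X]
    {W' : Type*} [NormedAddCommGroup W'] [NormedSpace ℝ W']
    {B : X → W →L[ℝ] W →L[ℝ] W'} {b c : X → W} {y : X}
    (hB : DifferentiableAt ℝ B y) (hb : DifferentiableAt ℝ b y) (hc : DifferentiableAt ℝ c y)
    (u : X) :
    fderiv ℝ (fun y' ↦ B y' (b y') (c y')) y u
      = fderiv ℝ B y u (b y) (c y) + B y (fderiv ℝ b y u) (c y) + B y (b y) (fderiv ℝ c y u) := by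
  rw [fderiv_clm_apply (hB.clm_apply hb) hc, fderiv_clm_apply hB hb]
  simp
  abel

variable {g : Π p : P, TangentSpace J p →L[ℝ] TangentSpace J p →L[ℝ] ℝ} {Φ : P → W}
  {G : W → W →L[ℝ] W →L[ℝ] ℝ} {θ : W → W →L[ℝ] ℝ} {S : W → W →L[ℝ] W →L[ℝ] W}

namespace IsAmbientModel

variable [J.Boundaryless]

theorem metricInChart_apply (h : IsAmbientModel J g Φ G θ S) (p : P)
    {y : F} (hy : y ∈ (extChartAt J p).target) (v w : F) :
    metricInChart J g p y v w = G (inChart J Φ p y) (fderiv ℝ (inChart J Φ p) y v)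
      (fderiv ℝ (inChart J Φ p) y w) := by
  rw [fderiv_inChart_eq_mvfderiv p (h.contMDiff _) hy, fderiv_inChart_eq_mvfderiv p (h.contMDiff _) hy]
  exact h.metric_eq _ _ _

theorem inChart_self (Φ : P → W) (p : P) : inChart J Φ p (extChartAt J p p) = Φ p := by
  simp [inChart]

theorem form_fderiv_inChart (h : IsAmbientModel J g Φ G θ S) (p : P)
    {y : F} (hy : y ∈ (extChartAt J p).target) (v : F) :
    θ (inChart J Φ p y) (fderiv ℝ (inChart J Φ p) y v) = 0 := by
  rw [fderiv_inChart_eq_mvfderiv p (h.contMDiff _) hy]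
  exact h.form_tangent _ _

theorem differentiableAt_inChart (h : IsAmbientModel J g Φ G θ S) (p : P) :
    DifferentiableAt ℝ (inChart J Φ p) (extChartAt J p p) :=
  (contDiffAt_inChart p (mem_chart_source K p) (h.contMDiff p)).differentiableAt (by simp)

theorem differentiableAt_metric (h : IsAmbientModel J g Φ G θ S) (p : P) :
    DifferentiableAt ℝ G (Φ p) :=
  (h.contDiffAt_metric p).differentiableAt (by simp)

theorem differentiableAt_connection (h : IsAmbientModel J g Φ G θ S) (p : P) :
    DifferentiableAt ℝ S (Φ p) :=
  (h.contDiffAt_connection p).differentiableAt (by simp)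

theorem form_self (h : IsAmbientModel J g Φ G θ S) (p : P) (v : F) :
    θ (Φ p) (fderiv ℝ (inChart J Φ p) (extChartAt J p p) v) = 0 := by
  have := h.form_fderiv_inChart p (mem_extChartAt_target p) v
  rwa [inChart_self] at this

theorem sndDeriv_symm (h : IsAmbientModel J g Φ G θ S) (p : P) (u v : F) :
    fderiv ℝ (fderiv ℝ (inChart J Φ p)) (extChartAt J p p) u v
      = fderiv ℝ (fderiv ℝ (inChart J Φ p)) (extChartAt J p p) v u :=
  ((contDiffAt_inChart p (mem_chart_source K p) (h.contMDiff p)).isSymmSndFDerivAt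
    (by simp [minSmoothness_of_isRCLikeNormedField]; exact WithTop.coe_le_coe.2 le_top)).eq u v

theorem fderiv_fderiv_inChart_apply (h : IsAmbientModel J g Φ G θ S) (p : P) (u v : F) :
    fderiv ℝ (fun y ↦ fderiv ℝ (inChart J Φ p) y v) (extChartAt J p p) u
      = fderiv ℝ (fderiv ℝ (inChart J Φ p)) (extChartAt J p p) u v := by
  rw [fderiv_clm_apply (differentiableAt_fderiv_inChart (h.contMDiff p))
    (differentiableAt_const v)]
  simp

theorem differentiableAt_fderiv_inChart_apply (h : IsAmbientModel J g Φ G θ S) (p : P) (v : F) :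
    DifferentiableAt ℝ (fun y ↦ fderiv ℝ (inChart J Φ p) y v) (extChartAt J p p) :=
  (differentiableAt_fderiv_inChart (h.contMDiff p)).clm_apply (differentiableAt_const v)

/-- The second derivative of the parametrization, corrected by the connection form, is tangent. -/
theorem form_gauss (h : IsAmbientModel J g Φ G θ S) (p : P) (u v : F) :
    θ (Φ p) (fderiv ℝ (fderiv ℝ (inChart J Φ p)) (extChartAt J p p) u v
      + S (Φ p) (fderiv ℝ (inChart J Φ p) (extChartAt J p p) u)
        (fderiv ℝ (inChart J Φ p) (extChartAt J p p) v)) = 0 := by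
  -- Differentiating `θ(dψ v) = 0` gives `θ(D²ψ(u, v)) + Dθ(dψ u)(dψ v) = 0`, where `ψ` is `Φ` in
  -- the chart; `tangent_compatible` rewrites the second term as `θ(S(dψ u, dψ v))`.
  have h0 : (fun y ↦ θ (inChart J Φ p y) (fderiv ℝ (inChart J Φ p) y v))
      =ᶠ[𝓝 (extChartAt J p p)] fun _ ↦ 0 := by
    filter_upwards [extChartAt_target_mem_nhds (I := J) p] with y hy
    exact h.form_fderiv_inChart p hy v
  have hθ := (h.contDiffAt_form p).differentiableAt (by simp)
  have hψ := h.differentiableAt_inChart p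
  have h1 : fderiv ℝ (fun y ↦ θ (inChart J Φ p y) (fderiv ℝ (inChart J Φ p) y v))
      (extChartAt J p p) u = 0 := by
    rw [h0.fderiv_eq]
    simp
  rw [fderiv_clm_apply (c := fun y ↦ θ (inChart J Φ p y))
    (differentiableAt_comp_of_eq (inChart_self Φ p) hθ hψ)
    (h.differentiableAt_fderiv_inChart_apply p v)] at h1
  simp only [add_apply, ContinuousLinearMap.comp_apply,
    ContinuousLinearMap.flip_apply, fderiv_comp_apply_of_eq (inChart_self Φ p) hθ hψ,
    h.fderiv_fderiv_inChart_apply, inChart_self] at h1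
  rw [map_add, h.tangent_compatible p _ _ (h.form_self p u) (h.form_self p v)]
  exact h1

theorem metricInChart_eventuallyEq (h : IsAmbientModel J g Φ G θ S) (p : P) (v w : F) :
    (fun y ↦ metricInChart J g p y v w) =ᶠ[𝓝 (extChartAt J p p)]
      fun y ↦ G (inChart J Φ p y) (fderiv ℝ (inChart J Φ p) y v)
        (fderiv ℝ (inChart J Φ p) y w) := by
  filter_upwards [extChartAt_target_mem_nhds (I := J) p] with y hy
  exact h.metricInChart_apply p hy v w

theorem differentiableAt_metricInChart (h : IsAmbientModel J g Φ G θ S) (p : P) :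
    DifferentiableAt ℝ (metricInChart J g p) (extChartAt J p p) := by
  have hG : DifferentiableAt ℝ (fun y ↦ G (inChart J Φ p y)) (extChartAt J p p) :=
    differentiableAt_comp_of_eq (Ψ := G) (inChart_self Φ p) (h.differentiableAt_metric p)
      (h.differentiableAt_inChart p)
  have hA := differentiableAt_fderiv_inChart (h.contMDiff p)
  have hpre : DifferentiableAt ℝ
      (fun y ↦ (ContinuousLinearMap.compL ℝ F W ℝ).flip (fderiv ℝ (inChart J Φ p) y))
      (extChartAt J p p) :=
    differentiableAt_comp_of_eq (Ψ := fun L ↦ (ContinuousLinearMap.compL ℝ F W ℝ).flip L) rfl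
      (ContinuousLinearMap.compL ℝ F W ℝ).flip.differentiableAt hA
  have : DifferentiableAt ℝ (fun y ↦ ((ContinuousLinearMap.compL ℝ F W ℝ).flip
      (fderiv ℝ (inChart J Φ p) y)).comp ((G (inChart J Φ p y)).comp (fderiv ℝ (inChart J Φ p) y))) (extChartAt J p p) :=
    hpre.clm_comp (hG.clm_comp hA)
  refine this.congr_of_eventuallyEq ?_
  filter_upwards [extChartAt_target_mem_nhds (I := J) p] with y hy
  ext v w
  exact h.metricInChart_apply p hy v w

/-- This is `∂_u g(v, w) = G(Q(u, v), dψ w) + G(dψ v, Q(u, w))` with `Q(u, v) = D²ψ(u, v) + S(dψ u,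
dψ v)`: the product rule, with the derivative of `G` replaced through `metric_compatible`. -/
theorem fderiv_metricInChart (h : IsAmbientModel J g Φ G θ S) (p : P) (u v w : F) :
    fderiv ℝ (metricInChart J g p) (extChartAt J p p) u v w
      = G (Φ p) (fderiv ℝ (fderiv ℝ (inChart J Φ p)) (extChartAt J p p) u v
          + S (Φ p) (fderiv ℝ (inChart J Φ p) (extChartAt J p p) u)
            (fderiv ℝ (inChart J Φ p) (extChartAt J p p) v))
          (fderiv ℝ (inChart J Φ p) (extChartAt J p p) w)
        + G (Φ p) (fderiv ℝ (inChart J Φ p) (extChartAt J p p) v)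
          (fderiv ℝ (fderiv ℝ (inChart J Φ p)) (extChartAt J p p) u w
          + S (Φ p) (fderiv ℝ (inChart J Φ p) (extChartAt J p p) u)
            (fderiv ℝ (inChart J Φ p) (extChartAt J p p) w)) := by
  have hm := h.differentiableAt_metricInChart p
  have h1 : fderiv ℝ (metricInChart J g p) (extChartAt J p p) u v w
      = fderiv ℝ (fun y ↦ metricInChart J g p y v w) (extChartAt J p p) u := by
    rw [fderiv_clm_apply (hm.clm_apply (differentiableAt_const v)) (differentiableAt_const w),
      fderiv_clm_apply hm (differentiableAt_const v)]
    simp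
  have hG := h.differentiableAt_metric p
  have hψ := h.differentiableAt_inChart p
  rw [h1, (h.metricInChart_eventuallyEq p v w).fderiv_eq,
    fderiv_bilin_apply (B := fun y ↦ G (inChart J Φ p y))
      (differentiableAt_comp_of_eq (Ψ := G) (inChart_self Φ p) hG hψ)
      (h.differentiableAt_fderiv_inChart_apply p v) (h.differentiableAt_fderiv_inChart_apply p w),
    fderiv_comp_apply_of_eq (Ψ := G) (inChart_self Φ p) hG hψ, h.fderiv_fderiv_inChart_apply,
    h.fderiv_fderiv_inChart_apply, inChart_self,
    h.metric_compatible p _ _ _ (h.form_self p u) (h.form_self p v)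
      (h.form_self p w)]
  simp only [map_add, add_apply]
  ring

/-- The Christoffel symbols of `g`, in terms of the ambient connection. -/
theorem fderiv_inChart_christoffel [FiniteDimensional ℝ F] (h : IsAmbientModel J g Φ G θ S)
    (p : P) (u v : F) :
    fderiv ℝ (inChart J Φ p) (extChartAt J p p) (christoffel J g p (extChartAt J p p) u v)
      = fderiv ℝ (fderiv ℝ (inChart J Φ p)) (extChartAt J p p) u v
        + S (Φ p) (fderiv ℝ (inChart J Φ p) (extChartAt J p p) u)
          (fderiv ℝ (inChart J Φ p) (extChartAt J p p) v) := by
  set m := metricInChart J g p (extChartAt J p p) with hm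
  have happ : ∀ a b : F, m a b = G (Φ p) (fderiv ℝ (inChart J Φ p) (extChartAt J p p) a)
      (fderiv ℝ (inChart J Φ p) (extChartAt J p p) b) := by
    intro a b
    have := h.metricInChart_apply p (mem_extChartAt_target p) a b
    rwa [inChart_self] at this
  have hinj : ∀ a : F, m a = 0 → a = 0 := by
    intro a ha
    refine h.nondegenerate p a fun b ↦ ?_
    have hb : g p a b = m a b :=
      ((h.metric_eq p a b).trans (congrArg₂ (fun s t ↦ G (Φ p) s t)
        (mvfderiv_eq_fderiv_inChart_self (h.contMDiff p) a)
        (mvfderiv_eq_fderiv_inChart_self (h.contMDiff p) b))).trans (happ a b).symm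
    rw [hb, ha]
    rfl
  -- The right-hand side is tangent by `form_gauss`, so it is the image of some `q`; it remains to
  -- see that `q` satisfies the equation defining the Christoffel symbol.
  obtain ⟨q, hq⟩ : ∃ q : F, fderiv ℝ (inChart J Φ p) (extChartAt J p p) q
      = fderiv ℝ (fderiv ℝ (inChart J Φ p)) (extChartAt J p p) u v
        + S (Φ p) (fderiv ℝ (inChart J Φ p) (extChartAt J p p) u)
          (fderiv ℝ (inChart J Φ p) (extChartAt J p p) v) := by
    obtain ⟨q, hq⟩ := h.exists_tangent p _ (h.form_gauss p u v)
    exact ⟨q, by rw [← hq, mvfderiv_eq_fderiv_inChart_self (h.contMDiff _)]⟩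
  rw [← hq]
  congr 1
  have hmi : m.IsInvertible  := isInvertible_of_forall_eq_zero hinj
  have key : m q = (1 / 2 : ℝ) • (fderiv ℝ (metricInChart J g p) (extChartAt J p p) u v
      + fderiv ℝ (metricInChart J g p) (extChartAt J p p) v u
      - ((fderiv ℝ (metricInChart J g p) (extChartAt J p p)).flip u).flip v) := by
    -- Koszul formula: `Q(a, b) = D²ψ(a, b) + S(dψ a, dψ b)` is symmetric, so of the six terms in
    -- the three metric derivatives four cancel and `2 G(Q(u, v), dψ w)` is left.
    ext w
    have hQ : ∀ a b : F, fderiv ℝ (fderiv ℝ (inChart J Φ p)) (extChartAt J p p) a b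
        + S (Φ p) (fderiv ℝ (inChart J Φ p) (extChartAt J p p) a)
          (fderiv ℝ (inChart J Φ p) (extChartAt J p p) b)
        = fderiv ℝ (fderiv ℝ (inChart J Φ p)) (extChartAt J p p) b a
        + S (Φ p) (fderiv ℝ (inChart J Φ p) (extChartAt J p p) b)
          (fderiv ℝ (inChart J Φ p) (extChartAt J p p) a) :=
      fun a b ↦ congrArg₂ (· + ·) (h.sndDeriv_symm p a b) (h.connection_symm _ _ _)
    simp only [smul_apply, sub_apply, add_apply, ContinuousLinearMap.flip_apply,
      h.fderiv_metricInChart, happ, hq, smul_eq_mul]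
    rw [hQ v u, hQ w u, hQ w v, h.metric_symm _ (fderiv ℝ (inChart J Φ p) (extChartAt J p p) v)]
    ring
  rw [christoffel, ← hm, ← key]
  exact hmi.inverse_apply_eq.2 rfl

variable {f : M → P} {V : Π x : M, TangentSpace J (f x)} {x : M}

/-- The Levi-Civita connection along `f` is induced by the ambient connection `D + S`. -/
theorem mvfderiv_covDerivAlong [FiniteDimensional ℝ F] [FiniteDimensional ℝ W]
    (h : IsAmbientModel J g Φ G θ S) (hf : MDifferentiableAt I J f x)
    (hV : MDifferentiableAt I 𝓘(ℝ, W) (fun x' ↦ mvfderiv J Φ (f x') (V x')) x)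
    (u : TangentSpace I x) :
    mvfderiv J Φ (f x) (covDerivAlong I J g f V x u)
      = mvfderiv I (fun x' ↦ mvfderiv J Φ (f x') (V x')) x u
        + S (Φ (f x)) (mvfderiv J Φ (f x) (mfderiv I J f x u)) (mvfderiv J Φ (f x) (V x)) := by
  -- The derivative of `dΦ(V)` is `D²ψ(df u, V)` plus `dΦ` of the derivative of the components,
  -- while `dΦ(Γ)` is `D²ψ + S`; the two occurrences of `D²ψ` match.
  have hc := mdifferentiableAt_compAlong (.of_forall h.contMDiff) hf (h.injective (f x)) hV
  rw [mvfderiv_mvfderiv_along (.of_forall h.contMDiff) hf hc]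
  have h2 := h.fderiv_inChart_christoffel (f x) (mfderiv I J f x u) (V x)
  have h1 : mvfderiv J Φ (f x) (covDerivAlong I J g f V x u)
      = mvfderiv J Φ (f x) (mvfderiv I (compAlong J (f x) V) x u : F)
        + mvfderiv J Φ (f x)
          (christoffel J g (f x) (extChartAt J (f x) (f x)) (mfderiv I J f x u) (V x) : F) :=
    (mvfderiv J Φ (f x)).map_add _ _
  have h3 := fun v ↦ mvfderiv_eq_fderiv_inChart_self (h.contMDiff (f x)) v
  rw [h1, (h3 (christoffel J g (f x) (extChartAt J (f x) (f x)) (mfderiv I J f x u) (V x)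
    : F)).trans h2, h3 (mfderiv I J f x u), h3 (V x)]
  abel

end IsAmbientModel

end AmbientModel

/-! ### Lie brackets and commutators of derivatives. -/

section Commutator

open scoped Topology

variable {E : Type*} [NormedAddCommGroup E] [NormedSpace ℝ E]
  {H : Type*} [TopologicalSpace H] {I : ModelWithCorners ℝ E H}
  {M : Type*} [TopologicalSpace M] [ChartedSpace H M] [IsManifold I ∞ M]
  {W : Type*} [NormedAddCommGroup W] [NormedSpace ℝ W]

variable (I) in
/-- The components, in the preferred chart around `x₀`, of the vector field `X`. -/
def compField (x₀ : M) (X : Π x : M, TangentSpace I x) : M → E :=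
  compAlong I (f := fun x ↦ x) x₀ X

variable {X Y : Π x : M, TangentSpace I x} {x : M} {h : M → W}

theorem mvfderiv_mvfderiv_field [I.Boundaryless] (hh : ∀ᶠ q in 𝓝 x, ContMDiffAt I 𝓘(ℝ, W) ∞ h q)
    (hX : MDifferentiableAt I 𝓘(ℝ, E) (compField I x X) x) (u : TangentSpace I x) :
    mvfderiv I (fun x' ↦ mvfderiv I h x' (X x')) x u
      = fderiv ℝ (fderiv ℝ (inChart I h x)) (extChartAt I x x) u (X x)
        + mvfderiv I h x (mvfderiv I (compField I x X) x u : E) := by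
  have := mvfderiv_mvfderiv_along (f := fun x : M ↦ x) (V := X) hh mdifferentiableAt_id hX u
  rw [show mfderiv I I (fun x : M ↦ x) x u = u by
    rw [show (fun x : M ↦ x) = id from rfl, mfderiv_id]; rfl] at this
  exact this

theorem mdifferentiableAt_compField (hX : MDifferentiableAt I I.tangent
    (fun x ↦ (⟨x, X x⟩ : TangentBundle I M)) x) :
    MDifferentiableAt I 𝓘(ℝ, E) (compField I x X) x :=
  (mdifferentiableAt_section I X).1 hX

variable (I) in
/-- The vector field `Z` in the preferred chart around `x`, as a function of the coordinates. -/
def fieldInChart (x : M) (Z : Π x : M, TangentSpace I x) (y : E) : E :=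
  VectorField.mpullbackWithin 𝓘(ℝ, E) I (extChartAt I x).symm Z (Set.range I) y

theorem fieldInChart_eq (x : M) (Z : Π x : M, TangentSpace I x) {y : E}
    (hy : y ∈ (extChartAt I x).target) :
    fieldInChart I x Z y = compField I x Z ((extChartAt I x).symm y) := by
  have hx' : (extChartAt I x).symm y ∈ (chartAt H x).source := by
    rw [← extChartAt_source I]; exact (extChartAt I x).map_target hy
  have h2 := TangentBundle.continuousLinearMapAt_trivializationAt (I := I) hx'
  rw [compField, compAlong, ← Trivialization.continuousLinearMapAt_apply_of_mem (R := ℝ) _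
    (by exact hx'), h2, fieldInChart, VectorField.mpullbackWithin_apply,
    ContinuousLinearMap.inverse_eq (mfderivWithin_extChartAt_symm_comp_mfderiv_extChartAt hy)
      (mfderiv_extChartAt_comp_mfderivWithin_extChartAt_symm hy)]
  rfl

theorem mvfderiv_compField [I.Boundaryless] [CompleteSpace E] {Z : Π x : M, TangentSpace I x}
    (hZ : MDifferentiableAt I I.tangent (fun x ↦ (⟨x, Z x⟩ : TangentBundle I M)) x)
    (u : TangentSpace I x) :
    mvfderiv I (compField I x Z) x u
      = fderiv ℝ (fieldInChart I x Z) (extChartAt I x x) u := by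
  have hd : DifferentiableAt ℝ (fieldInChart I x Z) (extChartAt I x x) := by
    have := hZ.mdifferentiableWithinAt (s := Set.univ)
      |>.differentiableWithinAt_mpullbackWithin_vectorField
    rw [Set.preimage_univ, Set.univ_inter] at this
    exact this.differentiableAt (by rw [I.range_eq_univ]; exact Filter.univ_mem)
  have he : compField I x Z =ᶠ[𝓝 x] fun x' ↦ (fieldInChart I x Z) (extChartAt I x x') := by
    filter_upwards [extChartAt_source_mem_nhds (I := I) x] with x' hx'
    refine Eq.trans ?_ (fieldInChart_eq x Z ((extChartAt I x).map_source hx')).symm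
    rw [(extChartAt I x).left_inv hx']
  have h1 := mvfderiv_fderiv_comp (I := I) (h := fun x' ↦ extChartAt I x x') rfl hd
    (mdifferentiableAt_extChartAt (mem_chart_source H x)) u
  have h2 := mvfderiv_extChartAt_comp (f := fun x : M ↦ x) (x := x) mdifferentiableAt_id u
  rw [mvfderiv_congr he, h1]
  refine congrArg _ (h2.trans ?_)
  rw [show (fun x : M ↦ x) = id from rfl, mfderiv_id]
  rfl

/-- The Lie bracket in the preferred chart. -/
theorem mlieBracket_eq [I.Boundaryless] [CompleteSpace E]
    (hX : MDifferentiableAt I I.tangent (fun x ↦ (⟨x, X x⟩ : TangentBundle I M)) x)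
    (hY : MDifferentiableAt I I.tangent (fun x ↦ (⟨x, Y x⟩ : TangentBundle I M)) x) :
    VectorField.mlieBracket I X Y x
      = ((mvfderiv I (compField I x Y) x (X x) - mvfderiv I (compField I x X) x (Y x) : E) :) := by
  have hval : ∀ Z : Π x : M, TangentSpace I x, fieldInChart I x Z (extChartAt I x x) = Z x := by
    intro Z
    refine (fieldInChart_eq x Z (mem_extChartAt_target x)).trans ?_
    rw [extChartAt_to_inv]
    exact compAlong_self (F := E) (J := I) (f := fun x : M ↦ x) (V := Z)
  -- The bracket is the flat bracket in the chart, transported back by the differential of the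
  -- chart, which is the identity at the centre `x`.
  have hb : VectorField.mlieBracket I X Y x = (((ContinuousLinearMap.id ℝ E).inverse
      (VectorField.lieBracketWithin (E := E) ℝ
        (fieldInChart I x X)
        (fieldInChart I x Y)
        ((extChartAt I x).symm ⁻¹' Set.univ ∩ Set.range I) (extChartAt I x x)) : E) :) := by
    rw [← VectorField.mlieBracketWithin_univ, VectorField.mlieBracketWithin_apply,
      mfderiv_extChartAt_self]
    rfl
  refine hb.trans ?_
  rw [mvfderiv_compField hX, mvfderiv_compField hY, ContinuousLinearMap.inverse_id,
    Set.preimage_univ, Set.univ_inter, ContinuousLinearMap.id_apply, VectorField.lieBracketWithin_eq]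
  refine congrArg₂ (fun a b : E ↦ a - b) ?_ ?_ <;>
  · rw [hval, I.range_eq_univ, fderivWithin_univ]

/-- The derivatives of a function along two vector fields commute up to the Lie bracket. -/
theorem mvfderiv_commutator [I.Boundaryless] [CompleteSpace E]
    (hh : ∀ᶠ q in 𝓝 x, ContMDiffAt I 𝓘(ℝ, W) ∞ h q)
    (hX : MDifferentiableAt I I.tangent (fun x ↦ (⟨x, X x⟩ : TangentBundle I M)) x)
    (hY : MDifferentiableAt I I.tangent (fun x ↦ (⟨x, Y x⟩ : TangentBundle I M)) x) :
    mvfderiv I (fun x' ↦ mvfderiv I h x' (Y x')) x (X x)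
      - mvfderiv I (fun x' ↦ mvfderiv I h x' (X x')) x (Y x)
      = mvfderiv I h x (VectorField.mlieBracket I X Y x) := by
  rw [mvfderiv_mvfderiv_field hh (mdifferentiableAt_compField hX),
    mvfderiv_mvfderiv_field hh (mdifferentiableAt_compField hY), mlieBracket_eq hX hY]
  -- By symmetry of the second derivative, only the derivatives of the components of `X` and `Y`
  -- survive, and they form the bracket.
  have hs := ((contDiffAt_inChart x (mem_chart_source H x) hh.self_of_nhds).isSymmSndFDerivAt
    (by simp [minSmoothness_of_isRCLikeNormedField]; exact WithTop.coe_le_coe.2 le_top)).eq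
      (X x) (Y x)
  have hm : mvfderiv I h x
      ((mvfderiv I (compField I x Y) x (X x) - mvfderiv I (compField I x X) x (Y x) : E) :)
      = mvfderiv I h x (mvfderiv I (compField I x Y) x (X x) : E)
        - mvfderiv I h x (mvfderiv I (compField I x X) x (Y x) : E) :=
    (mvfderiv I h x).map_sub _ _
  refine Eq.trans ?_ hm.symm
  rw [hs]
  abel

end Commutator

/-! ### Curvature of the connection along a map. -/

section CurvatureAlong

open scoped Topology

set_option synthInstance.maxHeartbeats 200000
set_option linter.unusedSectionVars false

variable {E : Type*} [NormedAddCommGroup E] [NormedSpace ℝ E]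
  {H : Type*} [TopologicalSpace H] {I : ModelWithCorners ℝ E H}
  {M : Type*} [TopologicalSpace M] [ChartedSpace H M] [IsManifold I ∞ M] [I.Boundaryless]
  {F : Type*} [NormedAddCommGroup F] [NormedSpace ℝ F] [FiniteDimensional ℝ F]
  {K : Type*} [TopologicalSpace K] {J : ModelWithCorners ℝ F K} [J.Boundaryless]
  {P : Type*} [TopologicalSpace P] [ChartedSpace K P] [IsManifold J ∞ P]
  {W : Type*} [NormedAddCommGroup W] [NormedSpace ℝ W] [FiniteDimensional ℝ W]

variable (J) in
/-- The vector field `V` along `f`, seen in the surrounding vector space. -/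
def ambientField (Φ : P → W) {f : M → P} (V : Π x : M, TangentSpace J (f x)) (x : M) : W :=
  mvfderiv J Φ (f x) (V x)

/-- The curvature `R(a, b)v` of the connection `D + S` of the vector space `W`. -/
def connectionCurvature (S : W → W →L[ℝ] W →L[ℝ] W) (w a b v : W) : W :=
  fderiv ℝ S w a b v - fderiv ℝ S w b a v + S w a (S w b v) - S w b (S w a v)

theorem contMDiffAt_mvfderiv_field {h : M → W} {X : Π x : M, TangentSpace I x} {x : M}
    (hh : ∀ᶠ q in 𝓝 x, ContMDiffAt I 𝓘(ℝ, W) ∞ h q)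
    (hX : ContMDiffAt I I.tangent ∞ (fun x ↦ (⟨x, X x⟩ : TangentBundle I M)) x) :
    ContMDiffAt I 𝓘(ℝ, W) ∞ (fun x' ↦ mvfderiv I h x' (X x')) x :=
  contMDiffAt_mvfderiv_along (f := fun x : M ↦ x) hh hX

namespace IsAmbientModel

variable {g : Π p : P, TangentSpace J p →L[ℝ] TangentSpace J p →L[ℝ] ℝ} {Φ : P → W}
  {G : W → W →L[ℝ] W →L[ℝ] ℝ} {θ : W → W →L[ℝ] ℝ} {S : W → W →L[ℝ] W →L[ℝ] W}
  {f : M → P} {V : Π x : M, TangentSpace J (f x)} {X Y : Π x : M, TangentSpace I x} {x : M}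

theorem contMDiff_comp (h : IsAmbientModel J g Φ G θ S) (hf : ContMDiff I J ∞ f) :
    ContMDiff I 𝓘(ℝ, W) ∞ (fun x ↦ Φ (f x)) :=
  h.contMDiff.comp hf

theorem mvfderiv_comp_apply (h : IsAmbientModel J g Φ G θ S) (hf : ContMDiff I J ∞ f)
    (u : TangentSpace I x) :
    mvfderiv J Φ (f x) (mfderiv I J f x u) = mvfderiv I (fun x ↦ Φ (f x)) x u :=
  (mfderiv_comp_apply x ((h.contMDiff (f x)).mdifferentiableAt (by simp))
    ((hf x).mdifferentiableAt (by simp)) u).symm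

theorem ambient_covDerivAlong (h : IsAmbientModel J g Φ G θ S) (hf : ContMDiff I J ∞ f)
    (hV : MDifferentiableAt I 𝓘(ℝ, W) (ambientField J Φ V) x) (u : TangentSpace I x) :
    mvfderiv J Φ (f x) (covDerivAlong I J g f V x u)
      = mvfderiv I (ambientField J Φ V) x u
        + S (Φ (f x)) (mvfderiv I (fun x ↦ Φ (f x)) x u) (ambientField J Φ V x) := by
  rw [h.mvfderiv_covDerivAlong ((hf x).mdifferentiableAt (by simp)) hV, h.mvfderiv_comp_apply hf]
  rfl

theorem ambientField_covDerivAlong (h : IsAmbientModel J g Φ G θ S) (hf : ContMDiff I J ∞ f)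
    (hV : ∀ᶠ q in 𝓝 x, ContMDiffAt I 𝓘(ℝ, W) ∞ (ambientField J Φ V) q) :
    ambientField J Φ (fun x' ↦ covDerivAlong I J g f V x' (Y x')) =ᶠ[𝓝 x]
      fun x' ↦ mvfderiv I (ambientField J Φ V) x' (Y x')
        + S (Φ (f x')) (mvfderiv I (fun x ↦ Φ (f x)) x' (Y x')) (ambientField J Φ V x') := by
  filter_upwards [hV] with x' hV'
  exact h.ambient_covDerivAlong hf (hV'.mdifferentiableAt (by simp)) (Y x')

theorem contMDiffAt_connection (h : IsAmbientModel J g Φ G θ S) (hf : ContMDiff I J ∞ f) :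
    ContMDiffAt I 𝓘(ℝ, W →L[ℝ] W →L[ℝ] W) ∞ (fun x ↦ S (Φ (f x))) x :=
  ContDiffAt.comp_contMDiffAt (g := S) (h.contDiffAt_connection (f x)) (h.contMDiff_comp hf x)

/-- Smoothness of the first covariant derivative, seen in `W`, is what makes the ambient formula
available for the second one. -/
theorem contMDiffAt_ambientField_covDerivAlong (h : IsAmbientModel J g Φ G θ S)
    (hf : ContMDiff I J ∞ f)
    (hV : ∀ᶠ q in 𝓝 x, ContMDiffAt I 𝓘(ℝ, W) ∞ (ambientField J Φ V) q)
    (hY : ContMDiffAt I I.tangent ∞ (fun x ↦ (⟨x, Y x⟩ : TangentBundle I M)) x) :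
    ContMDiffAt I 𝓘(ℝ, W) ∞
      (ambientField J Φ (fun x' ↦ covDerivAlong I J g f V x' (Y x'))) x := by
  refine ContMDiffAt.congr_of_eventuallyEq ?_ (h.ambientField_covDerivAlong hf hV)
  refine (contMDiffAt_mvfderiv_field hV hY).add (ContMDiffAt.clm_apply (ContMDiffAt.clm_apply
    (h.contMDiffAt_connection hf) (contMDiffAt_mvfderiv_field ?_ hY)) hV.self_of_nhds)
  exact .of_forall (h.contMDiff_comp hf)

theorem mvfderiv_ambientField_covDerivAlong (h : IsAmbientModel J g Φ G θ S)
    (hf : ContMDiff I J ∞ f)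
    (hV : ∀ᶠ q in 𝓝 x, ContMDiffAt I 𝓘(ℝ, W) ∞ (ambientField J Φ V) q)
    (hY : ContMDiffAt I I.tangent ∞ (fun x ↦ (⟨x, Y x⟩ : TangentBundle I M)) x)
    (u : TangentSpace I x) :
    mvfderiv I (ambientField J Φ (fun x' ↦ covDerivAlong I J g f V x' (Y x'))) x u
      = mvfderiv I (fun x' ↦ mvfderiv I (ambientField J Φ V) x' (Y x')) x u
        + fderiv ℝ S (Φ (f x)) (mvfderiv I (fun x ↦ Φ (f x)) x u)
          (mvfderiv I (fun x ↦ Φ (f x)) x (Y x)) (ambientField J Φ V x)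
        + S (Φ (f x)) (mvfderiv I (fun x' ↦ mvfderiv I (fun x ↦ Φ (f x)) x' (Y x')) x u)
          (ambientField J Φ V x)
        + S (Φ (f x)) (mvfderiv I (fun x ↦ Φ (f x)) x (Y x))
          (mvfderiv I (ambientField J Φ V) x u) := by
  have h0 : ∀ᶠ q in 𝓝 x, ContMDiffAt I 𝓘(ℝ, W) ∞ (fun x ↦ Φ (f x)) q :=
    .of_forall (h.contMDiff_comp hf)
  have h1 := (contMDiffAt_mvfderiv_field hV hY).mdifferentiableAt (by simp)
  have h2 := (contMDiffAt_mvfderiv_field h0 hY).mdifferentiableAt (by simp)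
  have h3 := (h.contMDiffAt_connection (x := x) hf).mdifferentiableAt (by simp)
  have h4 := hV.self_of_nhds.mdifferentiableAt (by simp)
  have h5 := MDifferentiableAt.clm_apply h3 h2
  rw [mvfderiv_congr (h.ambientField_covDerivAlong hf hV),
    mvfderiv_fun_add h1 (MDifferentiableAt.clm_apply h5 h4), add_apply,
    mvfderiv_clm_apply h5 h4, mvfderiv_clm_apply h3 h2,
    mvfderiv_fderiv_comp rfl (h.differentiableAt_connection (f x))
      (h0.self_of_nhds.mdifferentiableAt (by simp)), add_apply]
  abel

/-- Write `F = dΦ(V)`. Expanding both second derivatives, the mixed terms `S(XΦ, YF) + S(YΦ, XF)`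
are symmetric and cancel; the commutators of `F` and of `Φ ∘ f` give exactly the `[X, Y]` term. Only
the derivative of `S` and its quadratic terms remain, so the result depends on the values at `x`
alone. -/
theorem ambient_curvature_along [CompleteSpace E] (h : IsAmbientModel J g Φ G θ S)
    (hf : ContMDiff I J ∞ f)
    (hV : ∀ᶠ q in 𝓝 x, ContMDiffAt I 𝓘(ℝ, W) ∞ (ambientField J Φ V) q)
    (hX : ∀ᶠ q in 𝓝 x, ContMDiffAt I I.tangent ∞ (fun x ↦ (⟨x, X x⟩ : TangentBundle I M)) q)
    (hY : ∀ᶠ q in 𝓝 x, ContMDiffAt I I.tangent ∞ (fun x ↦ (⟨x, Y x⟩ : TangentBundle I M)) q) :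
    mvfderiv J Φ (f x)
      (covDerivAlong I J g f (fun x' ↦ covDerivAlong I J g f V x' (Y x')) x (X x)
        - covDerivAlong I J g f (fun x' ↦ covDerivAlong I J g f V x' (X x')) x (Y x)
        - covDerivAlong I J g f V x (VectorField.mlieBracket I X Y x))
      = connectionCurvature S (Φ (f x)) (mvfderiv I (fun x ↦ Φ (f x)) x (X x))
        (mvfderiv I (fun x ↦ Φ (f x)) x (Y x)) (ambientField J Φ V x) := by
  have h0 : ∀ᶠ q in 𝓝 x, ContMDiffAt I 𝓘(ℝ, W) ∞ (fun x ↦ Φ (f x)) q :=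
    .of_forall (h.contMDiff_comp hf)
  have hX1 := hX.self_of_nhds
  have hY1 := hY.self_of_nhds
  have hXd := hX1.mdifferentiableAt (by simp)
  have hYd := hY1.mdifferentiableAt (by simp)
  have hVd := hV.self_of_nhds.mdifferentiableAt (by simp)
  have c1 := mvfderiv_commutator hV hXd hYd
  have c2 := mvfderiv_commutator h0 hXd hYd
  rw [map_sub, map_sub,
    h.ambient_covDerivAlong hf ((h.contMDiffAt_ambientField_covDerivAlong hf hV
      hY1).mdifferentiableAt (by simp)),
    h.ambient_covDerivAlong hf ((h.contMDiffAt_ambientField_covDerivAlong hf hV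
      hX1).mdifferentiableAt (by simp)),
    h.ambient_covDerivAlong hf hVd, h.mvfderiv_ambientField_covDerivAlong hf hV hX1,
    h.mvfderiv_ambientField_covDerivAlong hf hV hY1,
    (h.ambientField_covDerivAlong hf hV).self_of_nhds,
    (h.ambientField_covDerivAlong hf hV).self_of_nhds, ← c1, ← c2, connectionCurvature]
  simp only [map_add, map_sub, sub_apply]
  abel

end IsAmbientModel

end CurvatureAlong

/-! ### The curvature tensor of the target. -/

section CurvatureTensor

open scoped Topology

set_option synthInstance.maxHeartbeats 200000
set_option linter.unusedSectionVars false

variable {F : Type*} [NormedAddCommGroup F] [NormedSpace ℝ F] [FiniteDimensional ℝ F]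
  {K : Type*} [TopologicalSpace K] {J : ModelWithCorners ℝ F K} [J.Boundaryless]
  {P : Type*} [TopologicalSpace P] [ChartedSpace K P] [IsManifold J ∞ P]
  {W : Type*} [NormedAddCommGroup W] [NormedSpace ℝ W] [FiniteDimensional ℝ W]
  {g : Π p : P, TangentSpace J p →L[ℝ] TangentSpace J p →L[ℝ] ℝ} {Φ : P → W}
  {G : W → W →L[ℝ] W →L[ℝ] ℝ} {θ : W → W →L[ℝ] ℝ} {S : W → W →L[ℝ] W →L[ℝ] W}

theorem eventually_contMDiffAt_extend (p : P) (u : TangentSpace J p) :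
    ∀ᶠ q in 𝓝 p, ContMDiffAt J J.tangent ∞
      (fun q ↦ (⟨q, FiberBundle.extend F u q⟩ : TangentBundle J P)) q := by
  obtain ⟨s, hs, h⟩ := FiberBundle.exists_contMDiffOn_extend (k := ∞) J F (V := TangentSpace J) u
  filter_upwards [eventually_mem_nhds_iff.2 hs] with q hq
  exact h.contMDiffAt hq

/-- The curvature formula along a map, for `id` and the constant-component extensions. Sharing its
right-hand side with the formula along `f` replaces a separate tensoriality argument. -/
theorem IsAmbientModel.ambient_curvatureTensor (h : IsAmbientModel J g Φ G θ S) (p : P)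
    (u v w : TangentSpace J p) :
    mvfderiv J Φ p (curvatureTensor J g p u v w)
      = connectionCurvature S (Φ p) (mvfderiv J Φ p u) (mvfderiv J Φ p v)
        (mvfderiv J Φ p w) := by
  have : CompleteSpace F := FiniteDimensional.complete ℝ F
  have hV : ∀ᶠ q in 𝓝 p, ContMDiffAt J 𝓘(ℝ, W) ∞
      (ambientField J Φ (f := id) (FiberBundle.extend F w : Π q : P, TangentSpace J q)) q := by
    filter_upwards [eventually_contMDiffAt_extend p w] with q hq
    exact contMDiffAt_mvfderiv_field (.of_forall h.contMDiff) hq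
  have key := h.ambient_curvature_along (f := id) contMDiff_id hV
    (eventually_contMDiffAt_extend p u) (eventually_contMDiffAt_extend p v)
  have e1 : (FiberBundle.extend F u : Π q : P, TangentSpace J q) p = u :=
    FiberBundle.extend_apply_self F u
  have e2 : (FiberBundle.extend F v : Π q : P, TangentSpace J q) p = v :=
    FiberBundle.extend_apply_self F v
  have e3 : (FiberBundle.extend F w : Π q : P, TangentSpace J q) p = w :=
    FiberBundle.extend_apply_self F w
  have e4 : ambientField J Φ (f := id) (FiberBundle.extend F w : Π q : P, TangentSpace J q) p = mvfderiv J Φ p w :=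
    congrArg (mvfderiv J Φ p) e3
  rw [e4, e1, e2] at key
  exact key

end CurvatureTensor

/-! ### Tangential and normal parts. -/

section Immersion

open scoped Topology

set_option synthInstance.maxHeartbeats 200000
set_option linter.unusedSectionVars false

variable {E : Type*} [NormedAddCommGroup E] [NormedSpace ℝ E] [FiniteDimensional ℝ E]
  {H : Type*} [TopologicalSpace H] {I : ModelWithCorners ℝ E H}
  {M : Type*} [TopologicalSpace M] [ChartedSpace H M] [IsManifold I ∞ M]
  {F : Type*} [NormedAddCommGroup F] [NormedSpace ℝ F]
  {K : Type*} [TopologicalSpace K] {J : ModelWithCorners ℝ F K}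
  {P : Type*} [TopologicalSpace P] [ChartedSpace K P] [IsManifold J ∞ P]
  {gM : Π x : M, TangentSpace I x →L[ℝ] TangentSpace I x →L[ℝ] ℝ}
  {g : Π p : P, TangentSpace J p →L[ℝ] TangentSpace J p →L[ℝ] ℝ} {f : M → P} {x : M}

/-- Nondegeneracy of `gM` in finite dimension makes the inverse in `tangentPart` a genuine one. -/
theorem apply_tangentPart (hgM : IsSemiRiemannianMetric I gM) (w : TangentSpace J (f x))
    (z : TangentSpace I x) :
    gM x (tangentPart I J gM g f x w) z = g (f x) w (mfderiv I J f x z) := by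
  have hi : (gM x).IsInvertible := isInvertible_of_forall_eq_zero (F := E) fun a ha ↦
    hgM.nondegenerate x a fun v ↦ congrArg (fun L : E →L[ℝ] ℝ ↦ L v) ha
  have := hi.self_apply_inverse ((g (f x) w).comp (mfderiv I J f x))
  exact congrArg (fun L : E →L[ℝ] ℝ ↦ L z) this

theorem IsSemiRiemannianMetric.eq_of_forall (hgM : IsSemiRiemannianMetric I gM)
    {u v : TangentSpace I x} (huv : ∀ z, gM x u z = gM x v z) : u = v := by
  refine sub_eq_zero.1 (hgM.nondegenerate x _ fun z ↦ ?_)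
  rw [map_sub, sub_apply, huv, sub_self]

theorem tangentPart_mfderiv (hgM : IsSemiRiemannianMetric I gM)
    (hf : IsIsometricImmersion I J gM g f) (u : TangentSpace I x) :
    tangentPart I J gM g f x (mfderiv I J f x u) = u :=
  hgM.eq_of_forall fun z ↦ (apply_tangentPart hgM _ z).trans (hf.isometric x u z).symm

theorem tangentPart_sub (w w' : TangentSpace J (f x)) :
    tangentPart I J gM g f x (w - w')
      = tangentPart I J gM g f x w - tangentPart I J gM g f x w' := by
  simp only [tangentPart, map_sub, ContinuousLinearMap.sub_comp]

theorem normalPart_sub (w w' : TangentSpace J (f x)) :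
    normalPart I J gM g f x (w - w')
      = normalPart I J gM g f x w - normalPart I J gM g f x w' := by
  simp only [normalPart, tangentPart_sub, map_sub]
  abel

theorem normalPart_zero : normalPart I J gM g f x 0 = 0 := by
  have := normalPart_sub (I := I) (gM := gM) (g := g) (x := x) (0 : TangentSpace J (f x)) 0
  rwa [sub_self, sub_self] at this

theorem normalPart_neg (w : TangentSpace J (f x)) :
    normalPart I J gM g f x (-w) = -normalPart I J gM g f x w := by
  rw [← zero_sub, normalPart_sub, normalPart_zero, zero_sub]

theorem normalPart_mfderiv (hgM : IsSemiRiemannianMetric I gM)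
    (hf : IsIsometricImmersion I J gM g f) (u : TangentSpace I x) :
    normalPart I J gM g f x (mfderiv I J f x u) = 0 := by
  rw [normalPart, tangentPart_mfderiv hgM hf, sub_self]

theorem normalPart_eq_of_sub_eq (hgM : IsSemiRiemannianMetric I gM)
    (hf : IsIsometricImmersion I J gM g f) {w w' : TangentSpace J (f x)} {u : TangentSpace I x}
    (h : w - w' = mfderiv I J f x u) :
    normalPart I J gM g f x w = normalPart I J gM g f x w' := by
  rw [← sub_eq_zero, ← normalPart_sub, h, normalPart_mfderiv hgM hf]

end Immersion

/-! ### Properties of the second fundamental form. -/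

section Ricci

open scoped Topology

set_option synthInstance.maxHeartbeats 200000
set_option linter.unusedSectionVars false

variable {E : Type*} [NormedAddCommGroup E] [NormedSpace ℝ E] [FiniteDimensional ℝ E]
  {H : Type*} [TopologicalSpace H] {I : ModelWithCorners ℝ E H}
  {M : Type*} [TopologicalSpace M] [ChartedSpace H M] [IsManifold I ∞ M] [I.Boundaryless]
  {F : Type*} [NormedAddCommGroup F] [NormedSpace ℝ F] [FiniteDimensional ℝ F]
  {K : Type*} [TopologicalSpace K] {J : ModelWithCorners ℝ F K} [J.Boundaryless]
  {P : Type*} [TopologicalSpace P] [ChartedSpace K P] [IsManifold J ∞ P]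
  {W : Type*} [NormedAddCommGroup W] [NormedSpace ℝ W] [FiniteDimensional ℝ W]
  {gM : Π x : M, TangentSpace I x →L[ℝ] TangentSpace I x →L[ℝ] ℝ}
  {g : Π p : P, TangentSpace J p →L[ℝ] TangentSpace J p →L[ℝ] ℝ} {Φ : P → W}
  {G : W → W →L[ℝ] W →L[ℝ] ℝ} {θ : W → W →L[ℝ] ℝ} {S : W → W →L[ℝ] W →L[ℝ] W}
  {f : M → P} {V V' : Π x : M, TangentSpace J (f x)} {T : Π x : M, TangentSpace I x} {x : M}

namespace IsAmbientModel

theorem ambient_injective (h : IsAmbientModel J g Φ G θ S) {p : P} {u v : TangentSpace J p}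
    (huv : mvfderiv J Φ p u = mvfderiv J Φ p v) : u = v := by
  refine sub_eq_zero.1 (h.injective p _ ?_)
  rw [map_sub, huv, sub_self]

theorem ambientField_sub :
    ambientField J Φ (fun x ↦ V x - V' x) = ambientField J Φ V - ambientField J Φ V' := by
  ext x
  simp [ambientField]

/-- Compared after applying the injective `dΦ`, where covariant differentiation is an ordinary
derivative plus a term linear in the field. -/
theorem covDerivAlong_sub (h : IsAmbientModel J g Φ G θ S) (hf : ContMDiff I J ∞ f)
    (hV : MDifferentiableAt I 𝓘(ℝ, W) (ambientField J Φ V) x)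
    (hV' : MDifferentiableAt I 𝓘(ℝ, W) (ambientField J Φ V') x) (u : TangentSpace I x) :
    covDerivAlong I J g f (fun x ↦ V x - V' x) x u
      = covDerivAlong I J g f V x u - covDerivAlong I J g f V' x u := by
  have hs : MDifferentiableAt I 𝓘(ℝ, W) (ambientField J Φ (fun x ↦ V x - V' x)) x := by
    rw [ambientField_sub]; exact hV.sub hV'
  refine h.ambient_injective ?_
  rw [map_sub, h.ambient_covDerivAlong hf hs, h.ambient_covDerivAlong hf hV,
    h.ambient_covDerivAlong hf hV', ambientField_sub, mvfderiv_sub hV hV']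
  simp only [Pi.sub_apply, map_sub, sub_apply]
  abel

theorem covDerivAlong_neg_direction (h : IsAmbientModel J g Φ G θ S) (hf : ContMDiff I J ∞ f)
    (hV : MDifferentiableAt I 𝓘(ℝ, W) (ambientField J Φ V) x) (u : TangentSpace I x) :
    covDerivAlong I J g f V x (-u) = -covDerivAlong I J g f V x u := by
  refine h.ambient_injective ?_
  rw [map_neg, h.ambient_covDerivAlong hf hV, h.ambient_covDerivAlong hf hV]
  simp only [map_neg, neg_apply]
  abel

theorem ambientField_mfderiv (h : IsAmbientModel J g Φ G θ S) (hf : ContMDiff I J ∞ f) :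
    ambientField J Φ (fun x ↦ mfderiv I J f x (T x))
      = fun x ↦ mvfderiv I (fun x ↦ Φ (f x)) x (T x) := by
  ext x
  exact h.mvfderiv_comp_apply hf (T x)

theorem mdifferentiableAt_ambientField_mfderiv (h : IsAmbientModel J g Φ G θ S)
    (hf : ContMDiff I J ∞ f) (hT : MDifferentiableAt I 𝓘(ℝ, E) (compField I x T) x) :
    MDifferentiableAt I 𝓘(ℝ, W) (ambientField J Φ (fun x ↦ mfderiv I J f x (T x))) x := by
  rw [h.ambientField_mfderiv hf]
  exact mdifferentiableAt_mvfderiv_along (f := fun x : M ↦ x) (.of_forall (h.contMDiff_comp hf))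
    mdifferentiableAt_id hT

/-- Modulo tangent vectors of `M`, the derivative of `df(T)` is the Hessian of `Φ ∘ f` plus `S`.
That expression depends on `T` only through `T x` and is symmetric, which yields both extension
independence and symmetry of the second fundamental form. -/
theorem ambient_covDerivAlong_mfderiv (h : IsAmbientModel J g Φ G θ S)
    (hf : ContMDiff I J ∞ f) (hT : MDifferentiableAt I 𝓘(ℝ, E) (compField I x T) x)
    (u : TangentSpace I x) :
    ∃ z : TangentSpace I x,
      mvfderiv J Φ (f x) (covDerivAlong I J g f (fun x ↦ mfderiv I J f x (T x)) x u)
        = fderiv ℝ (fderiv ℝ (inChart I (fun x ↦ Φ (f x)) x)) (extChartAt I x x) u (T x)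
          + S (Φ (f x)) (mvfderiv I (fun x ↦ Φ (f x)) x u)
            (mvfderiv I (fun x ↦ Φ (f x)) x (T x))
          + mvfderiv J Φ (f x) (mfderiv I J f x z) := by
  refine ⟨(mvfderiv I (compField I x T) x u : E), ?_⟩
  rw [h.ambient_covDerivAlong hf (h.mdifferentiableAt_ambientField_mfderiv hf hT),
    h.ambientField_mfderiv hf, mvfderiv_mvfderiv_field (.of_forall (h.contMDiff_comp hf)) hT]
  refine Eq.trans ?_ (congrArg₂ (· + ·) rfl (h.mvfderiv_comp_apply hf _).symm)
  exact add_right_comm _ _ _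

theorem mdifferentiableAt_compField_extend (v : TangentSpace I x) :
    MDifferentiableAt I 𝓘(ℝ, E) (compField I x (FiberBundle.extend E v)) x :=
  mdifferentiableAt_compField
    ((eventually_contMDiffAt_extend x v).self_of_nhds.mdifferentiableAt (by simp))

/-- The second fundamental form may be computed with any extension of the second argument. -/
theorem normalPart_covDerivAlong_mfderiv (h : IsAmbientModel J g Φ G θ S)
    (hgM : IsSemiRiemannianMetric I gM) (hf : IsIsometricImmersion I J gM g f)
    (hT : MDifferentiableAt I 𝓘(ℝ, E) (compField I x T) x) (u : TangentSpace I x) :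
    normalPart I J gM g f x (covDerivAlong I J g f (fun x ↦ mfderiv I J f x (T x)) x u)
      = secondFundamentalForm I J gM g f x u (T x) := by
  obtain ⟨z, hz⟩ := h.ambient_covDerivAlong_mfderiv hf.contMDiff hT u
  obtain ⟨z', hz'⟩ := h.ambient_covDerivAlong_mfderiv hf.contMDiff
    (mdifferentiableAt_compField_extend (T x)) u
  refine normalPart_eq_of_sub_eq hgM hf (u := z - z') (h.ambient_injective ?_)
  rw [map_sub, map_sub, map_sub, hz, hz', FiberBundle.extend_apply_self]
  abel

theorem secondFundamentalForm_symm (h : IsAmbientModel J g Φ G θ S)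
    (hgM : IsSemiRiemannianMetric I gM) (hf : IsIsometricImmersion I J gM g f)
    (u v : TangentSpace I x) :
    secondFundamentalForm I J gM g f x u v = secondFundamentalForm I J gM g f x v u := by
  obtain ⟨z, hz⟩ := h.ambient_covDerivAlong_mfderiv hf.contMDiff
    (mdifferentiableAt_compField_extend v) u
  obtain ⟨z', hz'⟩ := h.ambient_covDerivAlong_mfderiv hf.contMDiff
    (mdifferentiableAt_compField_extend u) v
  have hs := ((contDiffAt_inChart x (mem_chart_source H x)
    (h.contMDiff_comp hf.contMDiff x)).isSymmSndFDerivAt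
    (by simp [minSmoothness_of_isRCLikeNormedField]; exact WithTop.coe_le_coe.2 le_top)).eq u v
  refine normalPart_eq_of_sub_eq hgM hf (u := z - z') (h.ambient_injective ?_)
  rw [map_sub, map_sub, map_sub, hz, hz', FiberBundle.extend_apply_self,
    FiberBundle.extend_apply_self, hs, h.connection_symm _ (mvfderiv I (fun x ↦ Φ (f x)) x u)]
  abel

theorem secondFundamentalForm_neg_left (h : IsAmbientModel J g Φ G θ S)
    (hf : ContMDiff I J ∞ f) (u v : TangentSpace I x) :
    secondFundamentalForm I J gM g f x (-u) v = -secondFundamentalForm I J gM g f x u v := by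
  have := h.covDerivAlong_neg_direction hf
    (h.mdifferentiableAt_ambientField_mfderiv hf (mdifferentiableAt_compField_extend v)) u
  exact (congrArg _ this).trans (normalPart_neg _)

/-- The Levi-Civita connection along `f` is compatible with the metric. -/
theorem mvfderiv_metric (h : IsAmbientModel J g Φ G θ S) (hf : ContMDiff I J ∞ f)
    (hV : MDifferentiableAt I 𝓘(ℝ, W) (ambientField J Φ V) x)
    (hV' : MDifferentiableAt I 𝓘(ℝ, W) (ambientField J Φ V') x) (u : TangentSpace I x) :
    mvfderiv I (fun x ↦ g (f x) (V x) (V' x)) x u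
      = g (f x) (covDerivAlong I J g f V x u) (V' x)
        + g (f x) (V x) (covDerivAlong I J g f V' x u) := by
  have h0 : (fun x ↦ g (f x) (V x) (V' x))
      = fun x ↦ G (Φ (f x)) (ambientField J Φ V x) (ambientField J Φ V' x) := by
    ext x
    exact h.metric_eq _ _ _
  have hΦ := (h.contMDiff_comp hf x).mdifferentiableAt (by simp)
  have hG := mdifferentiableAt_comp_vector (Ψ := G) (h := fun x ↦ Φ (f x)) rfl (h.differentiableAt_metric (f x)) hΦ
  have hGV := MDifferentiableAt.clm_apply hG hV
  rw [h0, mvfderiv_clm_apply hGV hV', mvfderiv_clm_apply hG hV,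
    mvfderiv_fderiv_comp (Ψ := G) (h := fun x ↦ Φ (f x)) rfl (h.differentiableAt_metric (f x)) hΦ, add_apply,
    h.metric_eq, h.metric_eq, h.ambient_covDerivAlong hf hV, h.ambient_covDerivAlong hf hV',
    -- Compatibility is known only for vectors tangent to the model, hence the three tangency
    -- proofs.
    h.metric_compatible (f x) _ (ambientField J Φ V x) (ambientField J Φ V' x)
      (by rw [← h.mvfderiv_comp_apply hf]; exact h.form_tangent _ _)
      (h.form_tangent (f x) (V x)) (h.form_tangent (f x) (V' x))]
  simp only [map_add, add_apply, ambientField]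
  ring

end IsAmbientModel

end Ricci

/-! ### The shape operator and the Ricci equation. -/

section Ricci

open scoped Topology

set_option synthInstance.maxHeartbeats 200000
set_option linter.unusedSectionVars false

variable {E : Type*} [NormedAddCommGroup E] [NormedSpace ℝ E] [FiniteDimensional ℝ E]
  {H : Type*} [TopologicalSpace H] {I : ModelWithCorners ℝ E H}
  {M : Type*} [TopologicalSpace M] [ChartedSpace H M] [IsManifold I ∞ M] [I.Boundaryless]
  {F : Type*} [NormedAddCommGroup F] [NormedSpace ℝ F] [FiniteDimensional ℝ F]
  {K : Type*} [TopologicalSpace K] {J : ModelWithCorners ℝ F K} [J.Boundaryless]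
  {P : Type*} [TopologicalSpace P] [ChartedSpace K P] [IsManifold J ∞ P]
  {W : Type*} [NormedAddCommGroup W] [NormedSpace ℝ W] [FiniteDimensional ℝ W]
  {gM : Π x : M, TangentSpace I x →L[ℝ] TangentSpace I x →L[ℝ] ℝ}
  {g : Π p : P, TangentSpace J p →L[ℝ] TangentSpace J p →L[ℝ] ℝ} {Φ : P → W}
  {G : W → W →L[ℝ] W →L[ℝ] ℝ} {θ : W → W →L[ℝ] ℝ} {S : W → W →L[ℝ] W →L[ℝ] W}
  {f : M → P} {V V' : Π x : M, TangentSpace J (f x)} {T : Π x : M, TangentSpace I x} {x : M}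

namespace IsAmbientModel

theorem isometric_ambient (h : IsAmbientModel J g Φ G θ S)
    (hf : IsIsometricImmersion I J gM g f) (u v : TangentSpace I x) :
    gM x u v = G (Φ (f x)) (mvfderiv I (fun x ↦ Φ (f x)) x u)
      (mvfderiv I (fun x ↦ Φ (f x)) x v) := by
  rw [hf.isometric, h.metric_eq, h.mvfderiv_comp_apply hf.contMDiff,
    h.mvfderiv_comp_apply hf.contMDiff]

/-- The components of the tangential part solve a linear system whose matrix is the Gram matrix of
`gM`, invertible at `x`. Differentiability is needed because the tangential part of `∇_Z η` is
differentiated again in the Ricci equation. -/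
theorem mdifferentiableAt_compField_tangentPart (h : IsAmbientModel J g Φ G θ S)
    (hgM : IsSemiRiemannianMetric I gM) (hf : IsIsometricImmersion I J gM g f)
    (hV : MDifferentiableAt I 𝓘(ℝ, W) (ambientField J Φ V) x) :
    MDifferentiableAt I 𝓘(ℝ, E)
      (compField I x (fun x ↦ tangentPart I J gM g f x (V x))) x := by
  have hΦ := h.contMDiff_comp hf.contMDiff
  have hΦx := (hΦ x).mdifferentiableAt (by simp)
  set A : M → E →L[ℝ] W := fun x' ↦ fderiv ℝ (inChart I (fun x ↦ Φ (f x)) x) (extChartAt I x x')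
    with hAdef
  have hA : MDifferentiableAt I 𝓘(ℝ, E →L[ℝ] W) A x :=
    mdifferentiableAt_fderiv_inChart_comp (f := fun x : M ↦ x) (hΦ x) mdifferentiableAt_id
  have hG : MDifferentiableAt I 𝓘(ℝ, W →L[ℝ] W →L[ℝ] ℝ) (fun x' ↦ G (Φ (f x'))) x :=
    mdifferentiableAt_comp_vector (Ψ := G) (h := fun x ↦ Φ (f x)) rfl
      (h.differentiableAt_metric (f x)) hΦx
  have hpre : MDifferentiableAt I 𝓘(ℝ, (W →L[ℝ] ℝ) →L[ℝ] E →L[ℝ] ℝ)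
      (fun x' ↦ (ContinuousLinearMap.compL ℝ E W ℝ).flip (A x')) x :=
    mdifferentiableAt_comp_vector (Ψ := fun L ↦ (ContinuousLinearMap.compL ℝ E W ℝ).flip L) rfl
      (ContinuousLinearMap.compL ℝ E W ℝ).flip.differentiableAt hA
  have hk : MDifferentiableAt I 𝓘(ℝ, E →L[ℝ] E →L[ℝ] ℝ)
      (fun x' ↦ ((ContinuousLinearMap.compL ℝ E W ℝ).flip (A x')).comp
        ((G (Φ (f x'))).comp (A x'))) x :=
    MDifferentiableAt.clm_comp hpre (MDifferentiableAt.clm_comp hG hA)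
  have hb : MDifferentiableAt I 𝓘(ℝ, E →L[ℝ] ℝ)
      (fun x' ↦ (G (Φ (f x')) (ambientField J Φ V x')).comp (A x')) x :=
    MDifferentiableAt.clm_comp (MDifferentiableAt.clm_apply hG hV) hA
  refine MDifferentiableAt.of_clm_apply hk ?_ hb ?_
  · intro a ha
    refine hgM.nondegenerate x a fun b ↦ ?_
    exact (h.isometric_ambient hf (x := x) a b).trans
      ((congrArg₂ (fun s t ↦ G (Φ (f x)) s t) (mvfderiv_eq_fderiv_inChart_self (hΦ x) a)
        (mvfderiv_eq_fderiv_inChart_self (hΦ x) b)).trans (congrArg (fun L : E →L[ℝ] ℝ ↦ L b) ha))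
  · filter_upwards [(chartAt H x).open_source.mem_nhds (mem_chart_source H x)] with x' hx'
    have hAc : ∀ Z : TangentSpace I x', mvfderiv I (fun x ↦ Φ (f x)) x' Z
        = A x' (trivializationAt E (TangentSpace I) x (⟨x', Z⟩ : TangentBundle I M)).2 :=
      fun Z ↦ mvfderiv_eq_fderiv_inChart x (hΦ x') hx' Z
    ext a
    -- Each coordinate vector `a` is realized by a tangent vector at `x'`, so the system is the
    -- defining equation of the tangential part tested against `Z`.
    obtain ⟨Z, hZ⟩ : ∃ Z : TangentSpace I x',
        (trivializationAt E (TangentSpace I) x (⟨x', Z⟩ : TangentBundle I M)).2 = a :=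
      ⟨(trivializationAt E (TangentSpace I) x).symm x' a, congrArg Prod.snd
        (Trivialization.apply_mk_symm (trivializationAt E (TangentSpace I) x) (by exact hx') a)⟩
    have h1 := h.isometric_ambient hf (tangentPart I J gM g f x' (V x')) Z
    rw [apply_tangentPart hgM, h.metric_eq, h.mvfderiv_comp_apply hf.contMDiff, hAc, hAc, hZ] at h1
    exact h1.symm

/-- The shape operator is determined by the tangential component of the derivative of `η`. -/
theorem shapeOperator_eq (h : IsAmbientModel J g Φ G θ S)
    (hgM : IsSemiRiemannianMetric I gM) (hf : IsIsometricImmersion I J gM g f)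
    (hg : ∀ (p : P) (u v : TangentSpace J p), g p u v = g p v u)
    (hV : MDifferentiableAt I 𝓘(ℝ, W) (ambientField J Φ V) x)
    (hVn : ∀ᶠ x' in 𝓝 x, IsNormalTo I J g f x' (V x')) (u : TangentSpace I x) :
    shapeOperator I J gM g f x (V x) u
      = -tangentPart I J gM g f x (covDerivAlong I J g f V x u) := by
  have key : ∀ v : TangentSpace I x,
      gM x (-tangentPart I J gM g f x (covDerivAlong I J g f V x u)) v
        = g (f x) (secondFundamentalForm I J gM g f x u v) (V x) := by
    intro v
    have hT := h.mdifferentiableAt_ambientField_mfderiv hf.contMDiff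
      (mdifferentiableAt_compField_extend v)
    have hm := h.mvfderiv_metric hf.contMDiff hT hV u
    -- Normality on a neighbourhood allows differentiating `⟨df(v), η⟩ = 0`, which gives `⟨α(u, v),
    -- η⟩ = -⟨df(v), ∇_u η⟩`.
    have h0 : (fun x' ↦ g (f x') (mfderiv I J f x' (FiberBundle.extend E v x')) (V x'))
        =ᶠ[𝓝 x] fun _ ↦ (0 : ℝ) := by
      filter_upwards [hVn] with x' hx'
      rw [hg]
      exact hx' _
    rw [mvfderiv_congr h0, mvfderiv_const, zero_apply, FiberBundle.extend_apply_self] at hm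
    have h1 : g (f x) (secondFundamentalForm I J gM g f x u v) (V x)
        = g (f x) (covDerivAlong I J g f
          (fun x' ↦ mfderiv I J f x' (FiberBundle.extend E v x')) x u) (V x) := by
      rw [secondFundamentalForm, normalPart, map_sub, sub_apply, hg _ (mfderiv I J f x _),
        hVn.self_of_nhds, sub_zero]
    rw [h1, map_neg, neg_apply, apply_tangentPart hgM, hg]
    linarith
  have hex : ∃ a : TangentSpace I x, ∀ v : TangentSpace I x,
      gM x a v = g (f x) (secondFundamentalForm I J gM g f x u v) (V x) := ⟨_, key⟩
  -- Existence excludes the default value `0`, and nondegeneracy of `gM` identifies the chosen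
  -- vector.
  rw [shapeOperator, dif_pos hex]
  exact hgM.eq_of_forall fun z ↦ (hex.choose_spec z).trans (key z).symm

theorem metric_symm_of_model (h : IsAmbientModel J g Φ G θ S) (p : P) (u v : TangentSpace J p) :
    g p u v = g p v u := by
  rw [h.metric_eq, h.metric_eq, h.metric_symm]

/-- The Ricci equation: the normal curvature, in terms of the second fundamental form and the
normal component of the curvature of `g` along `f`. -/
theorem normalCurvature_eq (h : IsAmbientModel J g Φ G θ S)
    (hgM : IsSemiRiemannianMetric I gM) (hf : IsIsometricImmersion I J gM g f)
    {X Y : Π x : M, TangentSpace I x}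
    (hV : ∀ᶠ q in 𝓝 x, ContMDiffAt I 𝓘(ℝ, W) ∞ (ambientField J Φ V) q)
    (hVn : ∀ᶠ x' in 𝓝 x, IsNormalTo I J g f x' (V x'))
    (hX : ContMDiffAt I I.tangent ∞ (fun x ↦ (⟨x, X x⟩ : TangentBundle I M)) x)
    (hY : ContMDiffAt I I.tangent ∞ (fun x ↦ (⟨x, Y x⟩ : TangentBundle I M)) x) :
    normalCurvature I J gM g f X Y V x
      = normalPart I J gM g f x
        (covDerivAlong I J g f (fun x' ↦ covDerivAlong I J g f V x' (Y x')) x (X x)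
          - covDerivAlong I J g f (fun x' ↦ covDerivAlong I J g f V x' (X x')) x (Y x)
          - covDerivAlong I J g f V x (VectorField.mlieBracket I X Y x))
        + (secondFundamentalForm I J gM g f x (shapeOperator I J gM g f x (V x) (Y x)) (X x)
          - secondFundamentalForm I J gM g f x (shapeOperator I J gM g f x (V x) (X x)) (Y x)) := by
  -- Here `∇^⊥_Z η = ∇_Z η - df(T)`, where `T` is the tangential part of `∇_Z η`. Deriving along `u`
  -- and taking normal parts gives `(∇_u ∇_Z η)^⊥ - α(u, T)`, and `T = -A_η Z` at `x`.
  have step : ∀ {Z : Π x : M, TangentSpace I x} (u : TangentSpace I x),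
      ContMDiffAt I I.tangent ∞ (fun x ↦ (⟨x, Z x⟩ : TangentBundle I M)) x →
      normalConnection I J gM g f (fun x' ↦ normalConnection I J gM g f V x' (Z x')) x u
        = normalPart I J gM g f x
            (covDerivAlong I J g f (fun x' ↦ covDerivAlong I J g f V x' (Z x')) x u)
          + secondFundamentalForm I J gM g f x (shapeOperator I J gM g f x (V x) (Z x)) u := by
    intro Z u hZ
    have hc := (h.contMDiffAt_ambientField_covDerivAlong hf.contMDiff hV hZ).mdifferentiableAt
      (by simp)
    have hT := h.mdifferentiableAt_compField_tangentPart hgM hf hc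
    have e1 := h.covDerivAlong_sub hf.contMDiff hc
      (h.mdifferentiableAt_ambientField_mfderiv hf.contMDiff hT) u
    have e2 := h.normalPart_covDerivAlong_mfderiv hgM hf hT u
    rw [h.shapeOperator_eq hgM hf h.metric_symm_of_model
      (hV.self_of_nhds.mdifferentiableAt (by simp)) hVn,
      h.secondFundamentalForm_neg_left hf.contMDiff, h.secondFundamentalForm_symm hgM hf _ u,
      ← e2, ← sub_eq_add_neg, ← normalPart_sub, ← e1]
    rfl
  rw [normalCurvature, step _ hX, step _ hY, normalPart_sub, normalPart_sub]
  simp only [normalConnection]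
  abel

end IsAmbientModel

end Ricci

/-! ### The ambient connection of a warped product and its curvature. -/

section WarpedAmbient

set_option synthInstance.maxHeartbeats 200000

open ContinuousLinearMap

variable {V : Type*} [NormedAddCommGroup V] [NormedSpace ℝ V]

/-- The bilinear form `ε dt² + s(t) B` on `ℝ × V`. -/
def warpedForm (ε : ℝ) (s : ℝ → ℝ) (B : V →L[ℝ] V →L[ℝ] ℝ) (w : ℝ × V) :
    ℝ × V →L[ℝ] ℝ × V →L[ℝ] ℝ :=
  ε • (ContinuousLinearMap.mul ℝ ℝ).bilinearComp (fst ℝ ℝ V) (fst ℝ ℝ V)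
    + s w.1 • B.bilinearComp (snd ℝ ℝ V) (snd ℝ ℝ V)

/-- The form `(τ, v) ↦ B(ξ, v)` at `(t, ξ)`, whose kernel is tangent to the products of `ℝ` with the
quadrics of `B`. -/
def quadricForm (B : V →L[ℝ] V →L[ℝ] ℝ) (w : ℝ × V) : ℝ × V →L[ℝ] ℝ :=
  (B w.2).comp (snd ℝ ℝ V)

/-- The bilinear map `((τ, v), (τ', v')) ↦ (0, τ v' + τ' v)`. -/
def mixedProduct (V : Type*) [NormedAddCommGroup V] [NormedSpace ℝ V] :
    ℝ × V →L[ℝ] ℝ × V →L[ℝ] ℝ × V :=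
  (compL ℝ (ℝ × V) V (ℝ × V) (inr ℝ ℝ V)).comp
    ((lsmul ℝ ℝ).bilinearComp (fst ℝ ℝ V) (snd ℝ ℝ V)
      + ((lsmul ℝ ℝ).bilinearComp (fst ℝ ℝ V) (snd ℝ ℝ V)).flip)

/-- The bilinear map `(z, z') ↦ C(z, z') w`, depending linearly on `w`. -/
def smulBilin {W : Type*} [NormedAddCommGroup W] [NormedSpace ℝ W] (C : W →L[ℝ] W →L[ℝ] ℝ) :
    W →L[ℝ] W →L[ℝ] W →L[ℝ] W :=
  ((compL ℝ W (W →L[ℝ] ℝ) (W →L[ℝ] W)).flip C).comp ((compL ℝ W ℝ W).comp (lsmul ℝ ℝ).flip)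

theorem smulBilin_apply {W : Type*} [NormedAddCommGroup W] [NormedSpace ℝ W]
    (C : W →L[ℝ] W →L[ℝ] ℝ) (w z z' : W) : smulBilin C w z z' = C z z' • w := rfl

theorem contDiffAt_clm_comp {X W Y : Type*} [NormedAddCommGroup X] [NormedSpace ℝ X]
    [NormedAddCommGroup W] [NormedSpace ℝ W] [NormedAddCommGroup Y] [NormedSpace ℝ Y]
    (L : W →L[ℝ] Y) {r : X → W} {x : X} {m : WithTop ℕ∞} (hr : ContDiffAt ℝ m r x) :
    ContDiffAt ℝ m (fun x ↦ L (r x)) x :=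
  L.contDiff.contDiffAt.comp x hr

theorem hasFDerivAt_clm_comp {X W Y : Type*} [NormedAddCommGroup X] [NormedSpace ℝ X]
    [NormedAddCommGroup W] [NormedSpace ℝ W] [NormedAddCommGroup Y] [NormedSpace ℝ Y]
    (L : W →L[ℝ] Y) {r : X → W} {x : X} {r' : X →L[ℝ] W} (hr : HasFDerivAt r r' x) :
    HasFDerivAt (fun x ↦ L (r x)) (L.comp r') x :=
  L.hasFDerivAt.comp x hr

theorem contDiffAt_smulBilin {X W : Type*} [NormedAddCommGroup X] [NormedSpace ℝ X]
    [NormedAddCommGroup W] [NormedSpace ℝ W] (C : W →L[ℝ] W →L[ℝ] ℝ) {r : X → W} {x : X}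
    {m : WithTop ℕ∞} (hr : ContDiffAt ℝ m r x) : ContDiffAt ℝ m (fun x ↦ smulBilin C (r x)) x :=
  contDiffAt_clm_comp (Y := W →L[ℝ] W →L[ℝ] W) (smulBilin C) hr

theorem hasFDerivAt_smulBilin {X W : Type*} [NormedAddCommGroup X] [NormedSpace ℝ X]
    [NormedAddCommGroup W] [NormedSpace ℝ W] (C : W →L[ℝ] W →L[ℝ] ℝ) {r : X → W} {x : X}
    {r' : X →L[ℝ] W} (hr : HasFDerivAt r r' x) :
    HasFDerivAt (fun x ↦ smulBilin C (r x)) ((smulBilin C).comp r') x :=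
  hasFDerivAt_clm_comp (Y := W →L[ℝ] W →L[ℝ] W) (smulBilin C) hr

/-- The bilinear map `((τ, v), (τ', v')) ↦ (p(t) B(v, v'), q(t) (τ v' + τ' v) + c B(v, v') ξ)` at
`(t, ξ)`. -/
def warpedChristoffel (c : ℝ) (p q : ℝ → ℝ) (B : V →L[ℝ] V →L[ℝ] ℝ) (w : ℝ × V) :
    ℝ × V →L[ℝ] ℝ × V →L[ℝ] ℝ × V :=
  smulBilin (B.bilinearComp (snd ℝ ℝ V) (snd ℝ ℝ V)) (p w.1, c • w.2)
    + q w.1 • mixedProduct V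

variable {ε c : ℝ} {s p q : ℝ → ℝ} {B : V →L[ℝ] V →L[ℝ] ℝ} {w : ℝ × V}

theorem warpedForm_apply (z z' : ℝ × V) :
    warpedForm ε s B w z z' = ε * (z.1 * z'.1) + s w.1 * B z.2 z'.2 := by
  simp [warpedForm]

theorem quadricForm_apply (z : ℝ × V) : quadricForm B w z = B w.2 z.2 := rfl

theorem warpedChristoffel_apply (z z' : ℝ × V) :
    warpedChristoffel c p q B w z z'
      = (B z.2 z'.2 * p w.1, B z.2 z'.2 • c • w.2 + q w.1 • (z.1 • z'.2 + z'.1 • z.2)) := by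
  simp [warpedChristoffel, smulBilin_apply, mixedProduct]

theorem contDiffAt_smul_const {X Y : Type*} [NormedAddCommGroup X] [NormedSpace ℝ X]
    [NormedAddCommGroup Y] [NormedSpace ℝ Y] {r : X → ℝ} {x : X} {m : WithTop ℕ∞}
    (hr : ContDiffAt ℝ m r x) (y : Y) : ContDiffAt ℝ m (fun x ↦ r x • y) x :=
  hr.smul contDiffAt_const

theorem hasFDerivAt_smul_const {X Y : Type*} [NormedAddCommGroup X] [NormedSpace ℝ X]
    [NormedAddCommGroup Y] [NormedSpace ℝ Y] {r : X → ℝ} {r' : X →L[ℝ] ℝ} {x : X}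
    (hr : HasFDerivAt r r' x) (y : Y) :
    HasFDerivAt (fun x ↦ r x • y) ((toSpanSingleton ℝ y).comp r') x :=
  (toSpanSingleton ℝ y).hasFDerivAt.comp x hr

theorem contDiffAt_warpedForm (hs : ContDiffAt ℝ ∞ s w.1) : ContDiffAt ℝ ∞ (warpedForm ε s B) w := by
  have h : ContDiffAt ℝ ∞ (fun w : ℝ × V ↦ s w.1) w := hs.comp w contDiffAt_fst
  unfold warpedForm
  exact contDiffAt_const.add (contDiffAt_smul_const h _)

theorem contDiff_quadricForm : ContDiff ℝ ∞ (quadricForm B) := by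
  unfold quadricForm
  fun_prop

theorem contDiffAt_warpedChristoffel (hp : ContDiffAt ℝ ∞ p w.1) (hq : ContDiffAt ℝ ∞ q w.1) :
    ContDiffAt ℝ ∞ (warpedChristoffel c p q B) w := by
  have h1 : ContDiffAt ℝ ∞ (fun w : ℝ × V ↦ p w.1) w := hp.comp w contDiffAt_fst
  have h2 : ContDiffAt ℝ ∞ (fun w : ℝ × V ↦ q w.1) w := hq.comp w contDiffAt_fst
  have h3 : ContDiffAt ℝ ∞ (fun w : ℝ × V ↦ (p w.1, c • w.2)) w :=
    h1.prodMk (contDiffAt_snd.const_smul c)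
  unfold warpedChristoffel
  exact (contDiffAt_smulBilin _ h3).add (contDiffAt_smul_const h2 _)

theorem fderiv_warpedForm {s' : ℝ} (hs : HasDerivAt s s' w.1) (u z z' : ℝ × V) :
    fderiv ℝ (warpedForm ε s B) w u z z' = s' * u.1 * B z.2 z'.2 := by
  have h : HasFDerivAt (fun w : ℝ × V ↦ s w.1) (s' • fst ℝ ℝ V) w :=
    hs.comp_hasFDerivAt w hasFDerivAt_fst
  have h1 := (hasFDerivAt_smul_const h (B.bilinearComp (snd ℝ ℝ V) (snd ℝ ℝ V))).const_add
    (ε • (ContinuousLinearMap.mul ℝ ℝ).bilinearComp (fst ℝ ℝ V) (fst ℝ ℝ V))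
  have h2 : fderiv ℝ (warpedForm ε s B) w = _ := h1.fderiv
  rw [h2]
  simp [mul_assoc]

theorem fderiv_quadricForm (u z : ℝ × V) : fderiv ℝ (quadricForm B) w u z = B u.2 z.2 := by
  have h : quadricForm B = ((compL ℝ (ℝ × V) V ℝ).flip (snd ℝ ℝ V)).comp (B.comp (snd ℝ ℝ V)) := by
    ext <;> simp [quadricForm]
  rw [h, ContinuousLinearMap.fderiv]
  simp

theorem fderiv_warpedChristoffel {p' q' : ℝ} (hp : HasDerivAt p p' w.1) (hq : HasDerivAt q q' w.1)
    (u z z' : ℝ × V) :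
    fderiv ℝ (warpedChristoffel c p q B) w u z z'
      = (B z.2 z'.2 * (p' * u.1),
        B z.2 z'.2 • c • u.2 + (q' * u.1) • (z.1 • z'.2 + z'.1 • z.2)) := by
  have h1 : HasFDerivAt (fun w : ℝ × V ↦ p w.1) (p' • fst ℝ ℝ V) w :=
    hp.comp_hasFDerivAt w hasFDerivAt_fst
  have h2 : HasFDerivAt (fun w : ℝ × V ↦ q w.1) (q' • fst ℝ ℝ V) w :=
    hq.comp_hasFDerivAt w hasFDerivAt_fst
  have h3 : HasFDerivAt (fun w : ℝ × V ↦ c • w.2) (c • snd ℝ ℝ V) w :=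
    hasFDerivAt_snd.const_smul c
  have hd : DifferentiableAt ℝ (warpedChristoffel c p q B) w :=
    (hasFDerivAt_smulBilin (B.bilinearComp (snd ℝ ℝ V) (snd ℝ ℝ V)) (h1.prodMk h3)
      |>.add (hasFDerivAt_smul_const h2 (mixedProduct V))).differentiableAt
  -- With `z` and `z'` fixed, differentiating the operator-valued map and evaluating it is the same
  -- as differentiating its explicit value.
  have h4 := fderiv_bilin_apply hd (differentiableAt_const z) (differentiableAt_const z') u
  simp only [fderiv_fun_const, Pi.zero_apply, zero_apply, map_zero, add_zero,
    warpedChristoffel_apply] at h4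
  have h5 : HasFDerivAt (fun w : ℝ × V ↦
      (B z.2 z'.2 * p w.1, B z.2 z'.2 • c • w.2 + q w.1 • (z.1 • z'.2 + z'.1 • z.2))) _ w :=
    (h1.const_mul (B z.2 z'.2)).prodMk
      ((h3.const_smul (B z.2 z'.2)).add (hasFDerivAt_smul_const h2 (z.1 • z'.2 + z'.1 • z.2)))
  rw [← h4, h5.fderiv]
  simp [mul_smul]

/-- On tangent vectors `u`, `v`, and a vector `z` normal to both, the curvature operator of the
warped product has values in the plane of `u` and `v`. -/
theorem connectionCurvature_warped {a a' : ℝ → ℝ} {a'' : ℝ} (hε : ε * ε = 1)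
    (hB : ∀ v v', B v v' = B v' v)
    (ha : HasDerivAt a (a' w.1) w.1) (ha' : HasDerivAt a' a'' w.1) (h0 : a w.1 ≠ 0)
    {u v z : ℝ × V} (hu : B w.2 u.2 = 0) (hv : B w.2 v.2 = 0)
    (hzu : warpedForm ε (fun t ↦ a t ^ 2) B w z u = 0)
    (hzv : warpedForm ε (fun t ↦ a t ^ 2) B w z v = 0) :
    ∃ κ : ℝ, connectionCurvature
      (warpedChristoffel c (fun t ↦ -(ε * (a t * a' t))) (fun t ↦ a' t / a t) B) w u v z
        = κ • (u.1 • v - v.1 • u) := by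
  have hp : HasDerivAt (fun t ↦ -(ε * (a t * a' t))) (-(ε * (a' w.1 * a' w.1 + a w.1 * a''))) w.1 :=
    ((ha.mul ha').const_mul ε).neg
  have hq : HasDerivAt (fun t ↦ a' t / a t) ((a'' * a w.1 - a' w.1 * a' w.1) / a w.1 ^ 2) w.1 :=
    ha'.div ha h0
  rw [warpedForm_apply] at hzu hzv
  generalize hα : a w.1 = α at *
  generalize hα' : a' w.1 = α' at *
  -- Normality reads `ε z.1 u.1 + α² B(z, u) = 0`, so `B(z, u)` and `B(z, v)` are eliminated in
  -- favour of the `ℝ`-components.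
  have eu : B z.2 u.2 = -(ε * z.1 * u.1) / α ^ 2 := by field_simp; linarith
  have ev : B z.2 v.2 = -(ε * z.1 * v.1) / α ^ 2 := by field_simp; linarith
  have eu' : B u.2 z.2 = -(ε * z.1 * u.1) / α ^ 2 := by rw [hB, eu]
  have ev' : B v.2 z.2 = -(ε * z.1 * v.1) / α ^ 2 := by rw [hB, ev]
  have hu' : B u.2 w.2 = 0 := by rw [hB, hu]
  have hv' : B v.2 w.2 = 0 := by rw [hB, hv]
  have hε0 : ε ≠ 0 := left_ne_zero_of_mul (hε.trans_ne one_ne_zero)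
  -- The summand with `a''/α` comes from planes containing `∂_t`; the other one is the curvature `(c
  -- - ε a'²)/a²` of the fibre directions, times `ε z.1` from the elimination above.
  refine ⟨a'' / α * z.1 + (c - ε * α' ^ 2) * ε * z.1 / α ^ 2, ?_⟩
  unfold connectionCurvature
  rw [fderiv_warpedChristoffel hp hq, fderiv_warpedChristoffel hp hq]
  simp only [warpedChristoffel_apply, map_add, map_smul, smul_eq_mul, hα, hα', eu', ev', hu', hv',
    hB v.2 u.2]
  refine Prod.ext ?_ ?_
  · simp
    field_simp
    ring
  · simp
    match_scalars
    all_goals field_simp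
    all_goals try ring

end WarpedAmbient

/-! ### The ambient model of a warped product over a quadric. -/

section WarpedModel

set_option synthInstance.maxHeartbeats 200000

open scoped Topology

theorem contDiffAt_deriv {a : ℝ → ℝ} {t : ℝ} (ha : ContDiffAt ℝ ∞ a t) :
    ContDiffAt ℝ ∞ (deriv a) t := by
  have h1 : ContDiffAt ℝ ∞ (fun t ↦ fderiv ℝ a t 1) t :=
    (ha.fderiv_right (m := ∞) le_rfl).clm_apply contDiffAt_const
  exact h1

/-- If `F` and `ker θ` have the same dimension, an injective linear map from `F` to `W` with values
in `ker θ` maps onto `ker θ`. -/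
theorem exists_eq_of_injective_of_form_eq_zero {F W : Type*} [AddCommGroup F] [Module ℝ F]
    [AddCommGroup W] [Module ℝ W] [FiniteDimensional ℝ W]
    (hfr : Module.finrank ℝ W = Module.finrank ℝ F + 1) {L : F →ₗ[ℝ] W}
    (hL : ∀ u, L u = 0 → u = 0) {θ : W →ₗ[ℝ] ℝ} (hθ : θ ≠ 0) (hLθ : ∀ u, θ (L u) = 0)
    {z : W} (hz : θ z = 0) : ∃ u, L u = z := by
  have hle : LinearMap.range L ≤ LinearMap.ker θ := by
    rintro _ ⟨u, rfl⟩
    exact hLθ u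
  have h1 := LinearMap.finrank_range_of_inj ((injective_iff_map_eq_zero L).2 hL)
  have h2 := Module.Dual.finrank_ker_add_one_of_ne_zero (f := θ) hθ
  have h3 := Submodule.eq_of_le_of_finrank_eq hle (by omega)
  have h4 : z ∈ LinearMap.range L := by rw [h3]; exact hz
  exact h4

variable {F : Type*} [NormedAddCommGroup F] [NormedSpace ℝ F]
  {K : Type*} [TopologicalSpace K] {J : ModelWithCorners ℝ F K}
  {P : Type*} [TopologicalSpace P] [ChartedSpace K P]
  {V : Type*} [NormedAddCommGroup V] [NormedSpace ℝ V] [FiniteDimensional ℝ V]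

/-- A hypersurface `Φ` of `ℝ × V` contained in `{(t, ξ) : B(ξ, ξ) = c}`, with the metric induced by
`ε dt² + a(t)² B`. -/
theorem isAmbientModel_warped {g : Π p : P, TangentSpace J p →L[ℝ] TangentSpace J p →L[ℝ] ℝ}
    {τ : P → ℝ} {ξ : P → V} {B : V →L[ℝ] V →L[ℝ] ℝ} {ε c : ℝ} {a : ℝ → ℝ}
    (hε : ε * ε = 1) (hc : c * c = 1) (hB : ∀ v v', B v v' = B v' v)
    (hB' : ∀ v, (∀ v', B v v' = 0) → v = 0)
    (ha : ∀ p, ContDiffAt ℝ ∞ a (τ p)) (ha0 : ∀ p, a (τ p) ≠ 0)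
    (hτ : ContMDiff J 𝓘(ℝ, ℝ) ∞ τ) (hξ : ContMDiff J 𝓘(ℝ, V) ∞ ξ)
    (hξc : ∀ p, B (ξ p) (ξ p) = c)
    (hinj : ∀ (p : P) (u : TangentSpace J p), mvfderiv J (fun p ↦ (τ p, ξ p)) p u = 0 → u = 0)
    (hfr : Module.finrank ℝ V = Module.finrank ℝ F)
    (hg : ∀ (p : P) (u v : TangentSpace J p), g p u v = ε * (mvfderiv J τ p u * mvfderiv J τ p v)
      + a (τ p) ^ 2 * B (mvfderiv J ξ p u) (mvfderiv J ξ p v)) :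
    IsAmbientModel J g (fun p ↦ (τ p, ξ p)) (warpedForm ε (fun t ↦ a t ^ 2) B) (quadricForm B)
      (warpedChristoffel c (fun t ↦ -(ε * (a t * deriv a t))) (fun t ↦ deriv a t / a t) B) := by
  have hΦ : ContMDiff J 𝓘(ℝ, ℝ × V) ∞ (fun p ↦ (τ p, ξ p)) := hτ.prodMk_space hξ
  have hc0 : c ≠ 0 := left_ne_zero_of_mul (hc.trans_ne one_ne_zero)
  have hε0 : ε ≠ 0 := left_ne_zero_of_mul (hε.trans_ne one_ne_zero)
  have hda : ∀ p, HasDerivAt a (deriv a (τ p)) (τ p) := fun p ↦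
    ((ha p).differentiableAt (by simp)).hasDerivAt
  have hmetric : ∀ (p : P) (u v : TangentSpace J p),
      g p u v = warpedForm ε (fun t ↦ a t ^ 2) B (τ p, ξ p)
        (mvfderiv J (fun p ↦ (τ p, ξ p)) p u) (mvfderiv J (fun p ↦ (τ p, ξ p)) p v) := by
    intro p u v
    rw [warpedForm_apply, mvfderiv_prodMk ((hτ p).mdifferentiableAt (by simp))
      ((hξ p).mdifferentiableAt (by simp)), mvfderiv_prodMk ((hτ p).mdifferentiableAt (by simp))
      ((hξ p).mdifferentiableAt (by simp)), hg]
  have hform : ∀ (p : P) (u : TangentSpace J p),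
      quadricForm B (τ p, ξ p) (mvfderiv J (fun p ↦ (τ p, ξ p)) p u) = 0 := by
    intro p u
    -- Differentiating `B(ξ, ξ) = c` gives `2 B(ξ, dξ u) = 0`.
    have h1 := mvfderiv_clm_apply (k := fun p ↦ B (ξ p))
      (mdifferentiableAt_comp_vector (Ψ := B) rfl B.differentiableAt
        ((hξ p).mdifferentiableAt (by simp))) ((hξ p).mdifferentiableAt (by simp)) u
    rw [mvfderiv_fderiv_comp (Ψ := B) rfl B.differentiableAt ((hξ p).mdifferentiableAt (by simp)),
      B.fderiv, mvfderiv_congr (h' := fun _ ↦ c) (.of_forall hξc), mvfderiv_const, zero_apply,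
      hB _ (ξ p)] at h1
    rw [quadricForm_apply, mvfderiv_prodMk ((hτ p).mdifferentiableAt (by simp))
      ((hξ p).mdifferentiableAt (by simp))]
    show B (ξ p) (mvfderiv J ξ p u) = 0
    linarith
  have hsurj : ∀ (p : P) (z : ℝ × V), quadricForm B (τ p, ξ p) z = 0 →
      ∃ u, mvfderiv J (fun p ↦ (τ p, ξ p)) p u = z := by
    intro p z hz
    refine exists_eq_of_injective_of_form_eq_zero (F := F) (W := ℝ × V)
      (L := ContinuousLinearMap.toLinearMap (M := F) (mvfderiv J (fun p ↦ (τ p, ξ p)) p))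
      (θ := (quadricForm B (τ p, ξ p) : ℝ × V →ₗ[ℝ] ℝ)) ?_ (hinj p) ?_ (hform p) hz
    · rw [Module.finrank_prod, Module.finrank_self, hfr, add_comm]
      rfl
    -- The form is nonzero since its value at `(0, ξ)` is `B(ξ, ξ) = c ≠ 0`.
    · intro h0
      have h1 := LinearMap.congr_fun h0 (0, ξ p)
      exact hc0 ((hξc p).symm.trans h1)
  refine ⟨hΦ, hinj, hmetric, fun p u hu ↦ hinj p u ?_, hform, hsurj,
    fun p ↦ contDiffAt_warpedForm ((ha p).pow 2), fun p ↦ contDiff_quadricForm.contDiffAt,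
    fun p ↦ contDiffAt_warpedChristoffel
      (contDiffAt_const.mul ((ha p).mul (contDiffAt_deriv (ha p)))).neg
      ((contDiffAt_deriv (ha p)).div (ha p) (ha0 p)), fun w z z' ↦ ?_, fun w z z' ↦ ?_, ?_, ?_⟩
  -- A tangent `y` orthogonal to all tangent vectors vanishes: testing against `(1, 0)` kills its
  -- `ℝ`-component. Any `v` becomes tangent after subtracting `c B(ξ, v) ξ`, as `c² = 1`; since
  -- `B(y, ξ) = 0`, this yields `B(y, v) = 0`.
  · have h1 : ∀ z, quadricForm B (τ p, ξ p) z = 0 → warpedForm ε (fun t ↦ a t ^ 2) B (τ p, ξ p)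
        (mvfderiv J (fun p ↦ (τ p, ξ p)) p u) z = 0 := by
      intro z hz
      obtain ⟨v, rfl⟩ := hsurj p z hz
      rw [← hmetric, hu]
    have h0 := hform p u
    generalize mvfderiv J (fun p ↦ (τ p, ξ p)) p u = y at *
    have h2 : y.1 = 0 := by
      have := h1 (1, 0) (by simp [quadricForm_apply])
      simpa [warpedForm_apply, hε0] using this
    refine Prod.ext h2 (hB' _ fun v ↦ ?_)
    have h3 := h1 (0, v - (c * B (ξ p) v) • ξ p) (by
      rw [quadricForm_apply]
      simp only [map_sub, map_smul, smul_eq_mul, hξc]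
      linear_combination (-B (ξ p) v) * hc)
    rw [quadricForm_apply] at h0
    have h4 : B y.2 (ξ p) = 0 := (hB _ _).trans h0
    simpa [warpedForm_apply, h4, ha0 p] using h3
  · rw [warpedForm_apply, warpedForm_apply, hB z.2, mul_comm z.1]
  · rw [warpedChristoffel_apply, warpedChristoffel_apply, hB z.2, add_comm (z.1 • _)]
  · intro p z₁ z₂ z₃ h₁ h₂ h₃
    rw [quadricForm_apply] at h₁ h₂ h₃
    simp only [] at h₁ h₂ h₃
    have hs : HasDerivAt (fun t ↦ a t ^ 2) (2 * a (τ p) * deriv a (τ p)) (τ p) :=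
      ((hda p).pow 2).congr_deriv (by simp)
    rw [fderiv_warpedForm (w := (τ p, ξ p)) hs]
    simp only [warpedForm_apply, warpedChristoffel_apply, map_add, map_smul, add_apply, smul_apply,
      smul_eq_mul, h₃, hB z₂.2 (ξ p), h₂, hB z₂.2 z₁.2]
    have := ha0 p
    field_simp
    -- The terms from `a'/a` containing `z₂.1` or `z₃.1` cancel those from `-ε a a'`, because `ε² =
    -- 1`; the rest is the derivative `2 a a'` of `a²`.
    linear_combination (deriv a (τ p) * (B z₁.2 z₂.2 * z₃.1 + z₂.1 * B z₁.2 z₃.2)) * hε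
  · intro p z₁ z₂ h₁ h₂
    rw [quadricForm_apply] at h₁ h₂
    simp only [] at h₁ h₂
    rw [fderiv_quadricForm, quadricForm_apply, warpedChristoffel_apply]
    simp only [map_add, map_smul, smul_eq_mul, h₁, h₂, hξc]
    -- The summand `c B(z₁, z₂) ξ` is there for this: `θ` sends it to `c² B(z₁, z₂)`, the derivative
    -- of `θ`.
    linear_combination B z₁.2 z₂.2 * hc

end WarpedModel

/-! ### The warped products over the space forms. -/

section SpaceFormModel

set_option synthInstance.maxHeartbeats 200000

open scoped Topology

variable {N l : ℕ} {c : ℤˣ}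

theorem pseudoEuclideanForm_symm (ν : ℕ) (v v' : EuclideanSpace ℝ (Fin (N + 1))) :
    pseudoEuclideanForm N ν v v' = pseudoEuclideanForm N ν v' v := by
  simp only [Hyperquadric.form_apply, mul_comm (v _)]

theorem pseudoEuclideanForm_nondegenerate (ν : ℕ) (v : EuclideanSpace ℝ (Fin (N + 1)))
    (h : ∀ v', pseudoEuclideanForm N ν v v' = 0) : v = 0 := by
  ext i
  have h1 := h (EuclideanSpace.single i 1)
  rw [Hyperquadric.form_apply, Finset.sum_eq_single i (by simp +contextual) (by simp)] at h1
  have h2 := Hyperquadric.sign_mul_self N ν i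
  have h3 : pseudoSign N ν i ≠ 0 := left_ne_zero_of_mul (h2.trans_ne one_ne_zero)
  simpa [h3] using h1

/-- In the preferred chart the inclusion is the graph map, smooth where its radicand is positive. -/
theorem Hyperquadric.contMDiff_point :
    ContMDiff (𝓡 N) 𝓘(ℝ, EuclideanSpace ℝ (Fin (N + 1))) ∞ (point : Hyperquadric N l c → _) := by
  intro p
  refine contMDiffAt_iff.2 ⟨isInducing_point.continuous.continuousAt, ?_⟩
  -- The coordinate and sign are those built into `chartAt`, so that the inverse chart unfolds to
  -- `ofGraph`.
  set i := (exists_coord_ne_zero p).choose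
  set σ : ℝ := ((SignType.sign (p.point i) : SignType) : ℝ)
  have hp : 0 < σ * p.point i := mem_chart_source (EuclideanSpace ℝ (Fin N)) p
  have h0 : 0 < sqCoord l c i (dropCoord i p.point) := sqCoord_pos i hp
  have hσ : σ * σ = 1 := by
    rcases lt_or_gt_of_ne (right_ne_zero_of_mul hp.ne') with h | h <;> simp [σ, h]
  have hopen : IsOpen {y | 0 < sqCoord l c i y} :=
    isOpen_lt continuous_const (contDiff_sqCoord i).continuous
  have h1 : ContDiffAt ℝ ∞ (graphPoint l c i σ) (dropCoord i p.point) :=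
    (contDiffOn_graphPoint i σ).contDiffAt (hopen.mem_nhds h0)
  refine (h1.congr_of_eventuallyEq ?_).contDiffWithinAt
  filter_upwards [hopen.mem_nhds h0] with y hy
  exact ofGraph_point p i σ hσ hy

variable (I : TopologicalSpace.Opens ℝ) (p₀ : Hyperquadric N l c)

theorem contMDiff_interval : ContMDiff (𝓘(ℝ, ℝ).prod (𝓡 N)) 𝓘(ℝ, ℝ) ∞
    (fun q : I × spaceForm p₀ ↦ (q.1 : ℝ)) :=
  contMDiff_subtype_val.comp contMDiff_fst

theorem contMDiff_spaceForm_point :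
    ContMDiff (𝓘(ℝ, ℝ).prod (𝓡 N)) 𝓘(ℝ, EuclideanSpace ℝ (Fin (N + 1))) ∞
      (fun q : I × spaceForm p₀ ↦ q.2.1.point) :=
  Hyperquadric.contMDiff_point.comp (contMDiff_subtype_val.comp contMDiff_snd)

/-- Forgetting the coordinate `i` of `ξ` turns `(t, ξ)` into the chart itself, so the differential
of `(t, ξ)` has a left inverse. -/
theorem mvfderiv_interval_prod_point_injective (p : I × spaceForm p₀)
    (u : TangentSpace (𝓘(ℝ, ℝ).prod (𝓡 N)) p)
    (hu : mvfderiv (𝓘(ℝ, ℝ).prod (𝓡 N))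
      (fun q : I × spaceForm p₀ ↦ ((q.1 : ℝ), q.2.1.point)) p u = 0) : u = 0 := by
  have hΦ := (contMDiff_interval I p₀).prodMk_space (contMDiff_spaceForm_point I p₀)
  rw [mvfderiv_eq_fderiv_inChart_self (hΦ p)] at hu
  set Φ := fun q : I × spaceForm p₀ ↦ ((q.1 : ℝ), q.2.1.point)
  set i := (Hyperquadric.exists_coord_ne_zero p.2.1).choose
  let ρ : ℝ × EuclideanSpace ℝ (Fin (N + 1)) → ℝ × EuclideanSpace ℝ (Fin N) :=
    fun w ↦ (w.1, Hyperquadric.dropCoord i w.2)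
  have hρ : ContDiff ℝ ∞ ρ :=
    contDiff_fst.prodMk ((Hyperquadric.contDiff_dropCoord i).comp contDiff_snd)
  have hρΦ : ∀ q, ρ (Φ q) = extChartAt (𝓘(ℝ, ℝ).prod (𝓡 N)) p q := fun q ↦ rfl
  set y := extChartAt (𝓘(ℝ, ℝ).prod (𝓡 N)) p p with hy
  have h1 : (fun y' ↦ ρ (inChart (𝓘(ℝ, ℝ).prod (𝓡 N)) Φ p y')) =ᶠ[𝓝 y] id := by
    filter_upwards [extChartAt_target_mem_nhds (I := 𝓘(ℝ, ℝ).prod (𝓡 N)) p] with y' hy'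
    exact (hρΦ _).trans ((extChartAt (𝓘(ℝ, ℝ).prod (𝓡 N)) p).right_inv hy')
  have hd : DifferentiableAt ℝ (inChart (𝓘(ℝ, ℝ).prod (𝓡 N)) Φ p) y :=
    (contDiffAt_inChart p (mem_chart_source _ p) (hΦ p)).differentiableAt (by simp)
  have h2 := fderiv_comp_apply_of_eq rfl (hρ.differentiable (by simp) _) hd u
  rw [h1.fderiv_eq, fderiv_id, hu, map_zero] at h2
  exact h2

theorem isAmbientModel_warpedMetric (ε : ℤˣ) {a : ℝ → ℝ} (ha : ContDiffOn ℝ ∞ a I)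
    (ha_pos : ∀ t ∈ I, 0 < a t) :
    IsAmbientModel (𝓘(ℝ, ℝ).prod (𝓡 N)) (warpedMetric ε I a p₀)
      (fun q : I × spaceForm p₀ ↦ ((q.1 : ℝ), q.2.1.point))
      (warpedForm ((ε : ℤ) : ℝ) (fun t ↦ a t ^ 2) (pseudoEuclideanForm N (ambientIndex l c)))
      (quadricForm (pseudoEuclideanForm N (ambientIndex l c)))
      (warpedChristoffel ((c : ℤ) : ℝ) (fun t ↦ -(((ε : ℤ) : ℝ) * (a t * deriv a t)))
        (fun t ↦ deriv a t / a t) (pseudoEuclideanForm N (ambientIndex l c))) := by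
  refine isAmbientModel_warped (by exact_mod_cast Int.units_coe_mul_self ε)
    (by exact_mod_cast Int.units_coe_mul_self c) (pseudoEuclideanForm_symm _)
    (pseudoEuclideanForm_nondegenerate _)
    (fun p ↦ ha.contDiffAt (I.isOpen.mem_nhds p.1.2)) (fun p ↦ (ha_pos p.1 p.1.2).ne')
    (contMDiff_interval I p₀) (contMDiff_spaceForm_point I p₀) (fun p ↦ p.2.1.form_eq)
    (mvfderiv_interval_prod_point_injective I p₀) ?_ fun p u v ↦ ?_
  · simp [Module.finrank_prod, add_comm]
  · rfl

end SpaceFormModel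

/-! ### Recognizing tangent vectors of the submanifold in the ambient space. -/

section AmbientPlane

set_option linter.unusedSectionVars false
set_option synthInstance.maxHeartbeats 200000

variable {E : Type*} [NormedAddCommGroup E] [NormedSpace ℝ E] [FiniteDimensional ℝ E]
  {H : Type*} [TopologicalSpace H] {I : ModelWithCorners ℝ E H} [I.Boundaryless]
  {M : Type*} [TopologicalSpace M] [ChartedSpace H M] [IsManifold I ∞ M]
  {F : Type*} [NormedAddCommGroup F] [NormedSpace ℝ F] [FiniteDimensional ℝ F]
  {K : Type*} [TopologicalSpace K] {J : ModelWithCorners ℝ F K} [J.Boundaryless]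
  {P : Type*} [TopologicalSpace P] [ChartedSpace K P] [IsManifold J ∞ P]
  {W : Type*} [NormedAddCommGroup W] [NormedSpace ℝ W] [FiniteDimensional ℝ W]
  {gM : Π x : M, TangentSpace I x →L[ℝ] TangentSpace I x →L[ℝ] ℝ}
  {g : Π p : P, TangentSpace J p →L[ℝ] TangentSpace J p →L[ℝ] ℝ} {Φ : P → W}
  {G : W → W →L[ℝ] W →L[ℝ] ℝ} {θ : W → W →L[ℝ] ℝ} {S : W → W →L[ℝ] W →L[ℝ] W}
  {f : M → P} {x : M}

theorem IsAmbientModel.normalPart_eq_zero_of_ambient_eq (h : IsAmbientModel J g Φ G θ S)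
    (hgM : IsSemiRiemannianMetric I gM) (hf : IsIsometricImmersion I J gM g f)
    {w : TangentSpace J (f x)} {u : TangentSpace I x}
    (hw : mvfderiv J Φ (f x) w = mvfderiv I (fun x ↦ Φ (f x)) x u) :
    normalPart I J gM g f x w = 0 := by
  rw [h.ambient_injective (hw.trans (h.mvfderiv_comp_apply hf.contMDiff u).symm)]
  exact normalPart_mfderiv hgM hf u

end AmbientPlane

/-! ### Tangency of the curvature on a normal vector. -/

section WarpedCurvature

set_option synthInstance.maxHeartbeats 200000

variable {N l n : ℕ} {c ε : ℤˣ} {p₀ : Hyperquadric N l c} {I : TopologicalSpace.Opens ℝ}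
  {a : ℝ → ℝ} {M : Type*} [TopologicalSpace M] [ChartedSpace (EuclideanSpace ℝ (Fin n)) M]
  [IsManifold (𝓡 n) ∞ M]

/-- On two tangent vectors and a normal vector, the curvature operator of the warped product, as
an operator on the ambient vector space, takes values in the image of the tangent space. -/
theorem exists_connectionCurvature_eq (ha : ContDiffOn ℝ ∞ a I) (ha_pos : ∀ t ∈ I, 0 < a t)
    {f : M → I × spaceForm p₀} (hf : ContMDiff (𝓡 n) (𝓘(ℝ, ℝ).prod (𝓡 N)) ∞ f) {x : M}
    {w : TangentSpace (𝓘(ℝ, ℝ).prod (𝓡 N)) (f x)}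
    (hw : IsNormalTo (𝓡 n) (𝓘(ℝ, ℝ).prod (𝓡 N)) (warpedMetric ε I a p₀) f x w)
    (u v : TangentSpace (𝓡 n) x) :
    ∃ z : TangentSpace (𝓡 n) x, connectionCurvature
      (warpedChristoffel ((c : ℤ) : ℝ) (fun t ↦ -(((ε : ℤ) : ℝ) * (a t * deriv a t)))
        (fun t ↦ deriv a t / a t) (pseudoEuclideanForm N (ambientIndex l c)))
      ((f x).1, (f x).2.1.point)
      (mvfderiv (𝓡 n) (fun x ↦ (((f x).1 : ℝ), (f x).2.1.point)) x u)
      (mvfderiv (𝓡 n) (fun x ↦ (((f x).1 : ℝ), (f x).2.1.point)) x v)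
      (mvfderiv (𝓘(ℝ, ℝ).prod (𝓡 N))
        (fun q : I × spaceForm p₀ ↦ ((q.1 : ℝ), q.2.1.point)) (f x) w)
      = mvfderiv (𝓡 n) (fun x ↦ (((f x).1 : ℝ), (f x).2.1.point)) x z := by
  have h := isAmbientModel_warpedMetric I p₀ ε ha ha_pos
  have hΦ := h.mvfderiv_comp_apply hf (x := x)
  have hat : ContDiffAt ℝ ∞ a (f x).1 := ha.contDiffAt (I.isOpen.mem_nhds (f x).1.2)
  have hform : ∀ u : TangentSpace (𝓡 n) x,
      pseudoEuclideanForm N (ambientIndex l c) (f x).2.1.point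
        (mvfderiv (𝓡 n) (fun x ↦ (((f x).1 : ℝ), (f x).2.1.point)) x u).2 = 0 := by
    intro u
    rw [← hΦ u]
    exact h.form_tangent (f x) _
  have hnormal : ∀ u : TangentSpace (𝓡 n) x,
      warpedForm ((ε : ℤ) : ℝ) (fun t ↦ a t ^ 2) (pseudoEuclideanForm N (ambientIndex l c))
        ((f x).1, (f x).2.1.point)
        (mvfderiv (𝓘(ℝ, ℝ).prod (𝓡 N))
          (fun q : I × spaceForm p₀ ↦ ((q.1 : ℝ), q.2.1.point)) (f x) w)
        (mvfderiv (𝓡 n) (fun x ↦ (((f x).1 : ℝ), (f x).2.1.point)) x u) = 0 := by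
    intro u
    rw [← hΦ u]
    exact (h.metric_eq (f x) _ _).symm.trans (hw u)
  obtain ⟨κ, hκ⟩ := connectionCurvature_warped (w := (((f x).1 : ℝ), (f x).2.1.point))
    (c := ((c : ℤ) : ℝ)) (by exact_mod_cast Int.units_coe_mul_self ε) (pseudoEuclideanForm_symm _)
    (hat.differentiableAt (by simp)).hasDerivAt
    ((contDiffAt_deriv hat).differentiableAt (by simp)).hasDerivAt (ha_pos _ (f x).1.2).ne'
    (hform u) (hform v) (hnormal u) (hnormal v)
  -- The combination `dt(u) v - dt(v) u` makes sense in `T_x M`, and `d(Φ ∘ f)` maps it to the one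
  -- in `W`.
  exact ⟨κ • ((mvfderiv (𝓡 n) (fun x ↦ (((f x).1 : ℝ), (f x).2.1.point)) x u).1 • v
    - (mvfderiv (𝓡 n) (fun x ↦ (((f x).1 : ℝ), (f x).2.1.point)) x v).1 • u),
    hκ.trans (by simp only [map_smul, map_sub])⟩

end WarpedCurvature

end

/-- `I ×_a 𝕄^N_λ(c)` carries `⟨ , ⟩ = ε dt² + a² g`, and `f : M → εI ×_a 𝕄^N_λ(c)` is an isometric
immersion of the semi-Riemannian manifold `(M, gM)`. The fields `X`, `Y` and the normal field `η`
are smooth on an open set `U`; `U` is arbitrary, so this covers all tangent vectors `X`, `Y` and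
normal vectors `η` at all points. -/
theorem proposition3p4
    (N l : ℕ) (hN : 2 ≤ N) (hl : l ≤ N) (c ε : ℤˣ) (p₀ : Hyperquadric N l c)
    (I : TopologicalSpace.Opens ℝ) (a : ℝ → ℝ) (ha : ContDiffOn ℝ ∞ a I) (ha_pos : ∀ t ∈ I, 0 < a t)
    (n : ℕ) {M : Type*} [TopologicalSpace M] [ChartedSpace (EuclideanSpace ℝ (Fin n)) M]
    [IsManifold (𝓡 n) ∞ M]
    (gM : Π x : M, TangentSpace (𝓡 n) x →L[ℝ] TangentSpace (𝓡 n) x →L[ℝ] ℝ)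
    (hgM : IsSemiRiemannianMetric (𝓡 n) gM)
    (f : M → I × spaceForm p₀)
    (hf : IsIsometricImmersion (𝓡 n) (𝓘(ℝ, ℝ).prod (𝓡 N)) gM (warpedMetric ε I a p₀) f)
    (U : Set M) (hU : IsOpen U)
    (X Y : Π x : M, TangentSpace (𝓡 n) x)
    (hX : ContMDiffOn (𝓡 n) (𝓡 n).tangent ∞ (fun x ↦ (⟨x, X x⟩ : TangentBundle (𝓡 n) M)) U)
    (hY : ContMDiffOn (𝓡 n) (𝓡 n).tangent ∞ (fun x ↦ (⟨x, Y x⟩ : TangentBundle (𝓡 n) M)) U)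
    (η : Π x : M, TangentSpace (𝓘(ℝ, ℝ).prod (𝓡 N)) (f x))
    (hη : ContMDiffOn (𝓡 n) (𝓘(ℝ, ℝ).prod (𝓡 N)).tangent ∞
      (fun x ↦ (⟨f x, η x⟩ : TangentBundle (𝓘(ℝ, ℝ).prod (𝓡 N)) (I × spaceForm p₀))) U)
    (hη_normal : ∀ x ∈ U,
      IsNormalTo (𝓡 n) (𝓘(ℝ, ℝ).prod (𝓡 N)) (warpedMetric ε I a p₀) f x (η x)) :
    ∀ x ∈ U,
      normalCurvature (𝓡 n) (𝓘(ℝ, ℝ).prod (𝓡 N)) gM (warpedMetric ε I a p₀) f X Y η x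
        = secondFundamentalForm (𝓡 n) (𝓘(ℝ, ℝ).prod (𝓡 N)) gM (warpedMetric ε I a p₀) f x
            (shapeOperator (𝓡 n) (𝓘(ℝ, ℝ).prod (𝓡 N)) gM (warpedMetric ε I a p₀) f x (η x) (Y x))
            (X x)
          - secondFundamentalForm (𝓡 n) (𝓘(ℝ, ℝ).prod (𝓡 N)) gM (warpedMetric ε I a p₀) f x
            (shapeOperator (𝓡 n) (𝓘(ℝ, ℝ).prod (𝓡 N)) gM (warpedMetric ε I a p₀) f x (η x) (X x))
            (Y x)
      ∧ normalPart (𝓡 n) (𝓘(ℝ, ℝ).prod (𝓡 N)) gM (warpedMetric ε I a p₀) f x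
          (curvatureTensor (𝓘(ℝ, ℝ).prod (𝓡 N)) (warpedMetric ε I a p₀) (f x)
            (mfderiv (𝓡 n) (𝓘(ℝ, ℝ).prod (𝓡 N)) f x (X x))
            (mfderiv (𝓡 n) (𝓘(ℝ, ℝ).prod (𝓡 N)) f x (Y x)) (η x)) = 0 := by
  intro x hx
  have h := isAmbientModel_warpedMetric I p₀ ε ha ha_pos
  have hUx : ∀ᶠ q in nhds x, q ∈ U := hU.mem_nhds hx
  have hX' : ∀ q ∈ U, ContMDiffAt (𝓡 n) (𝓡 n).tangent ∞
      (fun x ↦ (⟨x, X x⟩ : TangentBundle (𝓡 n) M)) q := fun q hq ↦ hX.contMDiffAt (hU.mem_nhds hq)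
  have hY' : ∀ q ∈ U, ContMDiffAt (𝓡 n) (𝓡 n).tangent ∞
      (fun x ↦ (⟨x, Y x⟩ : TangentBundle (𝓡 n) M)) q := fun q hq ↦ hY.contMDiffAt (hU.mem_nhds hq)
  have hV := hUx.mono fun q hq ↦ contMDiffAt_mvfderiv_along (.of_forall h.contMDiff)
    (hη.contMDiffAt (hU.mem_nhds hq))
  -- One tangent vector `ζ` serves both claims: the curvature along `f` and the curvature tensor at
  -- `f x` have the same image in `W`.
  obtain ⟨ζ, hζ⟩ := exists_connectionCurvature_eq ha ha_pos hf.contMDiff (hη_normal x hx) (X x) (Y x)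
  have hR := h.normalPart_eq_zero_of_ambient_eq hgM hf
    (h.ambient_curvature_along hf.contMDiff hV (hUx.mono hX') (hUx.mono hY') |>.trans hζ)
  refine ⟨?_, ?_⟩
  · rw [h.normalCurvature_eq hgM hf hV (hUx.mono hη_normal) (hX' x hx) (hY' x hx), hR, zero_add]
  · refine h.normalPart_eq_zero_of_ambient_eq hgM hf (u := ζ)
      ((h.ambient_curvatureTensor _ _ _ _).trans ?_)
    rw [h.mvfderiv_comp_apply hf.contMDiff, h.mvfderiv_comp_apply hf.contMDiff]
    exact hζ
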